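/- Let $p$ be a prime and $n$ a positive integer with $p\nmid n$. Let $F$ be a finite extension of $\mathbb Q_p$ with ring of integers $R$, and assume that $F$ contains the group $\mu_n$ of $n$-th roots of unity (of order $n$). Let $\underline G$ be a split (connected) reductive group over $F$ with split maximal torus $\underline T$, root datum $(X,\Phi,Y,\Phi^\vee)$ and a choice of simple roots $\Delta$; identify $\underline T(F)$ with $Y\otimes F^\times$. Fix a Chevalley basis $\{H_\beta\}_{\beta\in\Delta}\cup\{X_\alpha\}_{\alpha\in\Phi}$ of the derived Lie algebra of $\underline G$, and let $\underline K\subset\underline G(F)$ be the largest compact subgroup whose adjoint action preserves the $R$-lattice spanned by this basis. Let $(\,,):Y\times Y\to\mathbb Z$ be a symmetric bilinear form, and let $$1\to\mu_n\to G\xrightarrow{\ \pi\ }\underline G(F)\to 1$$ be a central extension of topological groups such that, for all $y_1,y_2\in Y$, $t_1,t_2\in F^\times$ and all $g_1,g_2\in G$ with $\pi(g_i)=y_i\otimes t_i$, $$g_1g_2g_1^{-1}g_2^{-1}=(t_1,t_2)_n^{(y_1,y_2)},$$ where $(\,,)_n$ is the Hilbert norm residue symbol. Let $s:\underline K\to G$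 be a group homomorphism with $\pi\circ s=\mathrm{id}$, and put $K=s(\underline K)$, $T=\pi^{-1}(\underline T(F))$ (the metaplectic torus) and $T_0=T\cap K$. Let $\sigma$ be an irreducible complex representation of $T$ that is genuine, i.e. $\mu_n$ acts through a fixed injective character $\mu_n\to\mathbb C^\times$. If $\sigma$ is unramified, i.e. $\sigma^{T_0}\neq 0$, then $\dim_{\mathbb C}\sigma^{T_0}=1$. -/

import Mathlib

open scoped TensorProduct IntermediateField

noncomputable section

namespace MetaplecticTorus

/-! ### Affine algebraic groups

An affine group scheme over a field `k` is given by its commutative coordinate Hopf algebra `B`.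
All products below are convolution products, so that the group of rational points, the Lie algebra
and the adjoint action all live in the algebra of linear functionals on `B`. -/

section AlgebraicGroups

variable (k : Type*) [Field k] (B : Type*) [CommRing B] [HopfAlgebra k B]

/-- The group of `k`-rational points, with the convolution product. -/
abbrev Points : Type _ := WithConv (B →ₐ[k] k)

/-- The algebra of linear functionals on `B`, with the convolution product. -/
abbrev Functionals : Type _ := WithConv (B →ₗ[k] k)

variable {k B}

/-- A rational point, regarded as a linear functional (evaluation at the point). -/
def evalAt (g : Points k B) : Functionals k B := WithConv.toConv g.ofConv.toLinearMap

/-- Membership in the Lie algebra: derivations of `B` at the identity. The Lie bracket is the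
commutator for the convolution product. -/
def IsPointDerivation (D : Functionals k B) : Prop :=
  ∀ a b : B, D (a * b) =
    Coalgebra.counit (R := k) a * D b + D a * Coalgebra.counit (R := k) b

/-- The adjoint action of a rational point. -/
def adjoint (g : Points k B) (D : Functionals k B) : Functionals k B :=
  evalAt g * D * evalAt g⁻¹

/-- Right translation of regular functions by a rational point, `(g • f) (x) = f (x g)`. -/
def rightTranslation (g : Points k B) : B →ₗ[k] B :=
  (TensorProduct.rid k B).toLinearMap ∘ₗ
    TensorProduct.map LinearMap.id g.ofConv.toLinearMap ∘ₗ Coalgebra.comul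

/-- A point is unipotent if right translation by it is locally unipotent. -/
def IsUnipotentPoint (g : Points k B) : Prop :=
  ∀ a : B, ∃ m : ℕ, ((rightTranslation g - 1 : Module.End k B) ^ m) a = 0

/-- A subgroup of the group of points is Zariski closed if it is the zero set of some functions. -/
def IsZariskiClosed (U : Subgroup (Points k B)) : Prop :=
  ∃ S : Set B, ∀ g : Points k B, g ∈ U ↔ ∀ a ∈ S, g a = 0

/-- A subgroup of the group of points is Zariski connected (equivalently irreducible, when closed)
if its vanishing ideal is prime. -/
def IsZariskiConnected (U : Subgroup (Points k B)) : Prop :=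
  (⨅ u : U, RingHom.ker (u : Points k B).ofConv).IsPrime

variable (k B) in
/-- Over an algebraically closed field: the unipotent radical is trivial. -/
def HasTrivialUnipotentRadical : Prop :=
  ∀ U : Subgroup (Points k B), U.Normal → IsZariskiClosed U → IsZariskiConnected U →
    (∀ u ∈ U, IsUnipotentPoint u) → U = ⊥

/-- The ideal `I` of `B` cuts out a closed subgroup that is a split torus, that is, the quotient
Hopf algebra is the group algebra of a free abelian group of finite rank. -/
def IsTorusIdeal (k : Type*) [Field k] {B : Type*} [CommRing B] [HopfAlgebra k B]
    (I : Ideal B) : Prop :=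
  ∃ (r : ℕ) (f : B →ₐc[k] AddMonoidAlgebra k (Fin r → ℤ)),
    Function.Surjective f ∧ RingHom.ker f = I

end AlgebraicGroups

/-! ### Split reductive groups -/

section SplitReductive

variable {F : Type*} [Field F] {A : Type*} [CommRing A] [HopfAlgebra F A]
  {X : Type*} [AddCommGroup X]

/-- Restriction of functions `τ : A → F[X]` to a closed subgroup, the split torus with character
lattice `X`, exhibits the group `G` with coordinate algebra `A` as a (connected) split reductive
group with split maximal torus. Smoothness is automatic in characteristic zero. A maximal torus is
a torus whose ideal is minimal among ideals of tori, over the algebraic closure. -/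
structure IsSplitReductive (τ : A →ₐc[F] AddMonoidAlgebra F X) : Prop where
  finiteType : Algebra.FiniteType F A
  connected : IsDomain (AlgebraicClosure F ⊗[F] A)
  reductive : HasTrivialUnipotentRadical (AlgebraicClosure F) (AlgebraicClosure F ⊗[F] A)
  torus_closed : Function.Surjective τ
  torus_maximal : Minimal (IsTorusIdeal (AlgebraicClosure F) (B := AlgebraicClosure F ⊗[F] A))
    ((RingHom.ker τ).map
      (Algebra.TensorProduct.includeRight : A →ₐ[F] AlgebraicClosure F ⊗[F] A))

/-- The homomorphism from rational points of the torus to rational points of the group. -/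
def torusIncl (τ : A →ₐc[F] AddMonoidAlgebra F X) :
    Points F (AddMonoidAlgebra F X) →* Points F A where
  toFun t := WithConv.toConv (t.ofConv.comp (τ : A →ₐ[F] AddMonoidAlgebra F X))
  map_one' := by
    apply WithConv.ofConv_injective
    ext a
    change algebraMap F F (Coalgebra.counit (τ a)) = algebraMap F F (Coalgebra.counit a)
    simp
  map_mul' f g := by
    apply WithConv.ofConv_injective
    exact AlgHom.convMul_comp_bialgHom_distrib f g τ

/-- The subgroup of rational points of the torus in the group of rational points. -/
def torusPoints (τ : A →ₐc[F] AddMonoidAlgebra F X) : Subgroup (Points F A) :=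
  (torusIncl τ).range

/-- `D` is a vector of weight `x` in the Lie algebra, for the adjoint action of the torus. -/
def IsWeightVector (τ : A →ₐc[F] AddMonoidAlgebra F X) (x : X) (D : Functionals F A) : Prop :=
  IsPointDerivation D ∧ ∀ t : Points F (AddMonoidAlgebra F X),
    adjoint (torusIncl τ t) D = t (AddMonoidAlgebra.single x 1) • D

variable {Y : Type*} [AddCommGroup Y] {ι : Type*}

/-- The rational point `y ⊗ t` of the torus, on which the character `x` takes the value
`t ^ ⟨x, y⟩`, regarded as a rational point of the group. -/
def cochar (τ : A →ₐc[F] AddMonoidAlgebra F X) (P : RootPairing ι ℤ X Y) (y : Y) (t : Fˣ) :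
    Points F A :=
  torusIncl τ (WithConv.toConv (AddMonoidAlgebra.lift F F X ((Units.coeHom F).comp
    ((zpowersHom Fˣ t).comp
      (AddMonoidHom.toMultiplicative (P.toLinearMap.flip y).toAddMonoidHom)))))

/-- The differential at `1` of the cocharacter `y`, an element of the Lie algebra: it is the
derivation of `F[X]` at the identity sending the character `x` to `⟨x, y⟩`, restricted to `A`. -/
def cocharDeriv (τ : A →ₐc[F] AddMonoidAlgebra F X) (P : RootPairing ι ℤ X Y) (y : Y) :
    Functionals F A :=
  WithConv.toConv
    ((Finsupp.linearCombination F (fun x : X => ((P.toLinearMap x y : ℤ) : F)) ∘ₗ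
      (AddMonoidAlgebra.coeffLinearEquiv F).toLinearMap) ∘ₗ
        (τ : A →ₐ[F] AddMonoidAlgebra F X).toLinearMap)

/-- The roots of `P` are the roots of the group with respect to the torus. -/
def HasRoots (τ : A →ₐc[F] AddMonoidAlgebra F X) (P : RootPairing ι ℤ X Y) : Prop :=
  ∀ x : X, x ∈ Set.range P.root ↔ x ≠ 0 ∧ ∃ D, D ≠ 0 ∧ IsWeightVector τ x D

/-- The root vectors `e` (indexed by the roots), together with the differentials of the simple
coroots, form a Chevalley basis of the derived Lie algebra. The condition `bracket_neg` also says
that the coroots of `P` are the coroots of the group. -/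
structure IsChevalleySystem (τ : A →ₐc[F] AddMonoidAlgebra F X) (P : RootPairing ι ℤ X Y)
    (e : ι → Functionals F A) : Prop where
  isWeightVector : ∀ i, IsWeightVector τ (P.root i) (e i)
  bracket_neg : ∀ i j, P.root j = -P.root i → e i * e j - e j * e i = cocharDeriv τ P (P.coroot i)
  bracket_add : ∀ i j l, P.root l = P.root i + P.root j →
    ∀ r : ℕ, (∀ m : ℕ, P.root j - m • P.root i ∈ Set.range P.root ↔ m ≤ r) →
      e i * e j - e j * e i = (r + 1 : F) • e l ∨ e i * e j - e j * e i = -(r + 1 : F) • e l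

end SplitReductive

/-! ### Local fields -/

section LocalField

variable (F : Type*) [NormedField F] [IsUltrametricDist F]

/-- The ring of integers of a nonarchimedean normed field. -/
abbrev integers : Subring F := (NormedField.valuation (K := F)).integer

variable {F}

/-- The coordinate topology on rational points: the coarsest one making every regular function
continuous. -/
instance pointsTopology {A : Type*} [CommRing A] [HopfAlgebra F A] :
    TopologicalSpace (Points F A) :=
  TopologicalSpace.induced (fun g (a : A) => g a) inferInstance

variable {A : Type*} [CommRing A] [HopfAlgebra F A] {X : Type*} [AddCommGroup X]
  {Y : Type*} [AddCommGroup Y] {ι : Type*}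

/-- The lattice over the ring of integers spanned by the Chevalley basis: the root vectors and the
differentials of the simple coroots. -/
def chevalleyLattice (τ : A →ₐc[F] AddMonoidAlgebra F X) (P : RootPairing ι ℤ X Y) (b : P.Base)
    (e : ι → Functionals F A) : Submodule (integers F) (Functionals F A) :=
  Submodule.span (integers F)
    (Set.range e ∪ (fun i => cocharDeriv τ P (P.coroot i)) '' (b.support : Set ι))

/-- `K` is the maximal compact subgroup attached to the Chevalley basis: the largest compact
subgroup whose adjoint action preserves the lattice spanned by the Chevalley basis. -/
def IsChevalleyMaximalCompact (τ : A →ₐc[F] AddMonoidAlgebra F X) (P : RootPairing ι ℤ X Y)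
    (b : P.Base) (e : ι → Functionals F A) (K : Subgroup (Points F A)) : Prop :=
  IsGreatest {H : Subgroup (Points F A) | IsCompact (H : Set (Points F A)) ∧
    ∀ g ∈ H, ∀ v ∈ chevalleyLattice τ P b e, adjoint g v ∈ chevalleyLattice τ P b e} K

/-- The ring of integers of a finite extension `L` of `F` inside the algebraic closure. -/
abbrev extIntegers (L : IntermediateField F (AlgebraicClosure F)) :
    Subalgebra (integers F) L :=
  integralClosure (integers F) L

/-- The ring of integers of `L(α)`. -/
abbrev adjoinIntegers (L : IntermediateField F (AlgebraicClosure F)) (α : AlgebraicClosure F) :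
    Subalgebra (integers F) L⟮α⟯ :=
  integralClosure (integers F) L⟮α⟯

/-- `φ` is the (arithmetic) Frobenius of the extension `L(α) / L`, which is unramified, and `ϖ` is
a uniformizer of `L`: `ϖ` is a prime element of both rings of integers, and `φ x ≡ x ^ q` modulo
`ϖ` for all integral `x`, where `q` is the cardinality of the residue field of `L`. -/
def IsUnramifiedFrobenius (L : IntermediateField F (AlgebraicClosure F)) (α : AlgebraicClosure F)
    (ϖ : extIntegers L) (φ : L⟮α⟯ ≃ₐ[L] L⟮α⟯) : Prop :=
  Prime ϖ ∧ ∃ ϖ' : adjoinIntegers L α, (ϖ' : L⟮α⟯) = algebraMap L L⟮α⟯ ϖ ∧ Prime ϖ' ∧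
    ∀ x : adjoinIntegers L α, ∃ y : adjoinIntegers L α,
      φ x = ((x ^ Nat.card (extIntegers L ⧸ Ideal.span {ϖ}) + ϖ' * y : adjoinIntegers L α) : L⟮α⟯)

/-- `ζ` is the norm residue symbol of `a` and `b`: with `α ^ n = a` and `E = F(α)`, the element of
`Gal(E / F)` attached to `b` by local class field theory multiplies `α` by `ζ`.

The local reciprocity map is described here in the following explicit way: whenever `L / F` is a
finite extension with uniformizer `ϖ` such that `L E / L` is unramified, the Artin symbol in
`Gal(E / F)` of an element of `N_{L/F}(ϖ) * N_{E/F}(Eˣ)` is the restriction to `E` of the Frobenius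
automorphism of `L E / L`; and every element of `Fˣ` is of this form for some `L`. -/
def IsNormResidue (n : ℕ) (a b : Fˣ) (ζ : rootsOfUnity n F) : Prop :=
  ∃ α : AlgebraicClosure F, α ^ n = algebraMap F (AlgebraicClosure F) a ∧
    ∃ L : IntermediateField F (AlgebraicClosure F), FiniteDimensional F L ∧
      ∃ (ϖ : extIntegers L) (φ : L⟮α⟯ ≃ₐ[L] L⟮α⟯) (c : F⟮α⟯),
        IsUnramifiedFrobenius L α ϖ φ ∧
        (b : F) = Algebra.norm F (ϖ : L) * Algebra.norm F c ∧
        (φ (IntermediateField.AdjoinSimple.gen L α) : AlgebraicClosure F) =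
          algebraMap F (AlgebraicClosure F) (ζ : Fˣ) * α

open Classical in
/-- The Hilbert norm residue symbol `(a, b)_n`. By local class field theory, for a finite extension
`F` of `ℚ_p` containing the `n`-th roots of unity there is exactly one `ζ` with
`IsNormResidue n a b ζ`, so the second branch never occurs. -/
def hilbertSymbol (n : ℕ) (a b : Fˣ) : rootsOfUnity n F :=
  if h : ∃ ζ, IsNormResidue n a b ζ then h.choose else 1

end LocalField

/-! ### Central extensions and representations of the metaplectic torus -/

section Extensions

variable {M G H : Type*} [Group M] [TopologicalSpace M] [Group G] [TopologicalSpace G]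
  [Group H] [TopologicalSpace H]

/-- `1 → M → G → H → 1` is a central extension of topological groups. -/
structure IsTopologicalCentralExtension (inc : M →* G) (π : G →* H) : Prop where
  isEmbedding : Topology.IsEmbedding inc
  isOpenQuotientMap : IsOpenQuotientMap π
  exact : inc.range = π.ker
  central : inc.range ≤ Subgroup.center G

end Extensions

section Representations

variable {M G V : Type*} [Group M] [Group G] [AddCommGroup V] [Module ℂ V]

/-- The representation `σ` of the subgroup `T` is genuine, with respect to the faithful character
`ε` of `M`: the central subgroup `M` acts on it through `ε`. -/
def IsGenuine (inc : M →* G) (ε : M →* ℂˣ) (T : Subgroup G) (σ : Representation ℂ T V) : Prop :=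
  ∀ (t : T) (ζ : M), (t : G) = inc ζ → ∀ v : V, σ t v = (ε ζ : ℂ) • v

/-- The space of vectors in `σ` fixed by `T ∩ K`. -/
def fixedVectors (T K : Subgroup G) (σ : Representation ℂ T V) : Submodule ℂ V :=
  Representation.invariants (σ.comp (K.subgroupOf T).subtype)

end Representations

end MetaplecticTorus

end

/-! Write `T₀` for the part of the metaplectic torus `T` inside the image of `s`. It is abelian,
because `s` is a homomorphism and the torus itself is commutative. Conjugation by `t ∈ T` multiplies
each `x ∈ T₀` by a central element of `μ_n`, so `T` carries a fixed vector `v` to simultaneous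
eigenvectors of `T₀`; since `ε` is injective, the eigencharacter of `σ t v` is trivial exactly when
`t` centralizes `T₀`. Independence of eigenspaces then shows that the fixed space is spanned by the
translates of any nonzero fixed `v` under the centralizer, so it is irreducible under the
centralizer (`Representation.finrank_invariants_eq_one`).

The centralizer is abelian (`mul_comm_of_centralizes`). The torus is the product of the points `y ⊗
ϖ` and the integral torus, and the latter lies in the maximal compact subgroup. If lifts of `y₁ ⊗ ϖ`
and `y₂ ⊗ ϖ` centralize `T₀`, testing one against the lift of `y₁ ⊗ u`, with `u` a unit, gives `(u,
ϖ)_n ^ (y₁, y₂) = 1`. For a suitable `u` the symbol has order `n`, so `n ∣ (y₁, y₂)` and the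
commutator `(ϖ, ϖ)_n ^ (y₁, y₂)` is trivial. The cocharacter lattice is countable, so a fixed vector
generates a space of countable dimension, where Schur's lemma holds over `ℂ`; irreducibility under
an abelian group then forces dimension one.

The order of `(u, ϖ)_n` is read off the explicit description of the reciprocity map. Let `u` reduce
to a generator of the units of the residue field, of order `q`, and let `α ^ n = u`. Then `α` has
order `n (q - 1)` in every residue field, so `n` divides the residue degree of any extension
containing `α`, and norms from `F(α)` have valuation divisible by `n`. Hence an auxiliary `L` has
residue degree `f ≡ 1` modulo `n`, and the congruence `ζ α ≡ α ^ (q ^ f)` makes `n` divide the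
exponent of any trivial power of `ζ`. -/

/-! ### Schur's lemma in countable dimension -/

/-- A countable-dimensional form of Schur's lemma: an operator with empty spectrum on a nonzero
space would give uncountably many linearly independent vectors. -/
theorem Module.End.spectrum_nonempty_of_rank_le_aleph0 {W : Type*} [AddCommGroup W] [Module ℂ W]
    [Nontrivial W] (hW : Module.rank ℂ W ≤ Cardinal.aleph0) (f : Module.End ℂ W) :
    (spectrum ℂ f).Nonempty := by
  classical
  by_contra hne
  rw [Set.not_nonempty_iff_eq_empty] at hne
  obtain ⟨v, hv⟩ := exists_ne (0 : W)
  have hunit : ∀ q : Polynomial ℂ, q ≠ 0 → IsUnit (Polynomial.aeval f q) := by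
    intro q hq
    by_contra h
    have h' : ¬ IsUnit (Polynomial.aeval f
        (Multiset.map (fun x ↦ Polynomial.X - Polynomial.C x) q.roots).prod) := by
      intro h2
      apply h
      have hs := (IsAlgClosed.splits q).eq_prod_roots
      rw [hs, map_mul, Polynomial.aeval_C]
      exact IsUnit.mul ((isUnit_iff_ne_zero.mpr (Polynomial.leadingCoeff_ne_zero.mpr hq)).map
        (algebraMap ℂ (Module.End ℂ W))) h2
    obtain ⟨k, hk, -⟩ := spectrum.exists_mem_of_not_isUnit_aeval_prod h'
    simp [hne] at hk
  have hsurj : ∀ c : ℂ, ∃ w : W, Polynomial.aeval f (Polynomial.X - Polynomial.C c) w = v :=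
    fun c => ((Module.End.isUnit_iff _).mp (hunit _ (Polynomial.X_sub_C_ne_zero c))).surjective v
  choose w hw using hsurj
  have hli : LinearIndependent ℂ w := by
    rw [linearIndependent_iff']
    intro s g hg i hi
    -- `w c` plays the role of `v / (f - c)`. Multiplying the relation by the product of all `f - d`
    -- clears denominators and gives `q(f) v = 0`; nonzero polynomials in `f` are invertible, so `q
    -- = 0`, and evaluating at `i` isolates `g i`.
    set q : Polynomial ℂ := ∑ c ∈ s, Polynomial.C (g c) *
      ∏ d ∈ s.erase c, (Polynomial.X - Polynomial.C d) with hq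
    have h0 : Polynomial.aeval f q v = 0 := by
      have : Polynomial.aeval f (∏ d ∈ s, (Polynomial.X - Polynomial.C d)) (∑ c ∈ s, g c • w c)
          = Polynomial.aeval f q v := by
        rw [hq, map_sum, map_sum, LinearMap.sum_apply]
        refine Finset.sum_congr rfl fun c hc => ?_
        rw [← Finset.prod_erase_mul s _ hc, map_smul, map_mul, Module.End.mul_apply, hw c, map_mul,
          Polynomial.aeval_C, Module.End.mul_apply]
        rfl
      rw [← this, hg, map_zero]
    have hq0 : q = 0 := by
      by_contra hne
      apply hv
      exact ((Module.End.isUnit_iff _).mp (hunit q hne)).injective (by rw [h0, map_zero])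
    have he : q.eval i = g i * ∏ d ∈ s.erase i, (i - d) := by
      rw [hq, Polynomial.eval_finsetSum, Finset.sum_eq_single i]
      · simp [Polynomial.eval_prod]
      · intro c _ hci
        rw [Polynomial.eval_mul, Polynomial.eval_prod,
          Finset.prod_eq_zero (Finset.mem_erase.mpr ⟨Ne.symm hci, hi⟩) (by simp), mul_zero]
      · exact fun h => absurd hi h
    rw [hq0, Polynomial.eval_zero] at he
    refine (mul_eq_zero.mp he.symm).resolve_right (Finset.prod_ne_zero_iff.mpr fun d hd => ?_)
    exact sub_ne_zero.mpr (Finset.ne_of_mem_erase hd).symm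
  have hcard := hli.cardinal_lift_le_rank
  have h2 := hcard.trans (Cardinal.lift_le.mpr hW)
  rw [Cardinal.mk_complex] at h2
  simp only [Cardinal.lift_continuum, Cardinal.lift_aleph0] at h2
  exact absurd h2 (not_le.mpr Cardinal.aleph0_lt_continuum)

/-- A space of countable dimension that is irreducible under a set of commuting operators is
one-dimensional. -/
theorem finrank_eq_one_of_commute_of_irreducible {W : Type*} [AddCommGroup W] [Module ℂ W]
    [Nontrivial W] (hW : Module.rank ℂ W ≤ Cardinal.aleph0) (S : Set (Module.End ℂ W))
    (hS : ∀ f ∈ S, ∀ g ∈ S, Commute f g)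
    (hirr : ∀ U : Submodule ℂ W, (∀ f ∈ S, ∀ u ∈ U, f u ∈ U) → U = ⊥ ∨ U = ⊤) :
    Module.finrank ℂ W = 1 := by
  have hscal : ∀ f ∈ S, ∃ c : ℂ, ∀ u, f u = c • u := by
    intro f hf
    obtain ⟨c, hc⟩ := Module.End.spectrum_nonempty_of_rank_le_aleph0 hW f
    have hcomm : ∀ g ∈ S, ∀ u, g ((algebraMap ℂ (Module.End ℂ W) c - f) u) =
        (algebraMap ℂ (Module.End ℂ W) c - f) (g u) := by
      intro g hg u
      have := LinearMap.congr_fun (hS f hf g hg).eq u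
      simp only [Module.End.mul_apply] at this
      simp [Module.algebraMap_end_apply, this]
    -- Kernel and range of `c - f` are stable under `S`. If `c - f` were nonzero, irreducibility
    -- would make it bijective, contradicting that `c` is in the spectrum.
    have key : algebraMap ℂ (Module.End ℂ W) c - f = 0 := by
      by_contra hne
      apply hc
      rw [resolventSet, Set.mem_ofPred_eq, Module.End.isUnit_iff]
      constructor
      · rw [← LinearMap.ker_eq_bot]
        refine (hirr _ fun g hg u hu => ?_).resolve_right fun h => hne (LinearMap.ker_eq_top.mp h)
        rw [LinearMap.mem_ker] at hu ⊢
        rw [← hcomm g hg, hu, map_zero]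
      · rw [← LinearMap.range_eq_top]
        refine (hirr _ fun g hg u hu => ?_).resolve_left
          fun h => hne (LinearMap.range_eq_bot.mp h)
        obtain ⟨u, rfl⟩ := hu
        exact ⟨g u, (hcomm g hg u).symm⟩
    refine ⟨c, fun u => ?_⟩
    have := LinearMap.congr_fun key u
    simp only [LinearMap.sub_apply, Module.algebraMap_end_apply, LinearMap.zero_apply] at this
    exact (sub_eq_zero.mp this).symm
  obtain ⟨v, hv⟩ := exists_ne (0 : W)
  refine finrank_eq_one v hv fun w => ?_
  have htop : Submodule.span ℂ {v} = ⊤ := by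
    refine (hirr _ fun f hf u hu => ?_).resolve_left fun h => hv (by simpa using h)
    obtain ⟨c, hc⟩ := hscal f hf
    rw [hc]
    exact Submodule.smul_mem _ _ hu
  exact Submodule.mem_span_singleton.mp (htop ▸ Submodule.mem_top)

/-! ### Vectors fixed by an abelian subgroup -/

namespace Representation

variable {T V : Type*} [Group T] [AddCommGroup V] [Module ℂ V]

/-- In an irreducible representation every nonzero vector spans, up to translation. -/
theorem IsIrreducible.span_orbit_eq_top {σ : Representation ℂ T V} (hσ : σ.IsIrreducible)
    {v : V} (hv : v ≠ 0) : Submodule.span ℂ (Set.range fun t => σ t v) = ⊤ := by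
  let U : Subrepresentation σ :=
    { toSubmodule := Submodule.span ℂ (Set.range fun t => σ t v)
      apply_mem_toSubmodule := fun g w hw => by
        induction hw using Submodule.span_induction with
        | mem x hx =>
          obtain ⟨t, rfl⟩ := hx
          exact Submodule.subset_span ⟨g * t, by simp⟩
        | zero => simp
        | add x y _ _ hx hy => rw [map_add]; exact Submodule.add_mem _ hx hy
        | smul c x _ hx => rw [map_smul]; exact Submodule.smul_mem _ _ hx }
  have hmem : v ∈ U.toSubmodule := Submodule.subset_span ⟨1, by simp⟩
  rcases hσ.eq_bot_or_eq_top U with h | h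
  · rw [h] at hmem
    exact absurd ((Submodule.mem_bot ℂ).mp hmem) hv
  · exact congrArg Subrepresentation.toSubmodule h

/-- Suppose that conjugation by `T` changes the action of a commutative subgroup `T₀` only by scalars,
which are trivial only for commuting elements, and that the centralizer of `T₀` is commutative. Then the space
of `T₀`-fixed vectors in an irreducible representation of `T` of countable dimension, if nonzero, has
dimension one. -/
theorem finrank_invariants_eq_one {σ : Representation ℂ T V} (hσ : σ.IsIrreducible)
    (T₀ : Subgroup T) (hT₀ : ∀ x ∈ T₀, ∀ y ∈ T₀, x * y = y * x)
    (hchar : ∀ t, ∀ x ∈ T₀, ∃ c : ℂ, (∀ v, σ (t⁻¹ * x * t) v = c • σ x v) ∧ (c = 1 → t * x = x * t))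
    (hcent : ∀ t₁ ∈ Subgroup.centralizer (T₀ : Set T), ∀ t₂ ∈ Subgroup.centralizer (T₀ : Set T),
      t₁ * t₂ = t₂ * t₁)
    (C : Set T) (hC : C.Countable)
    (hcount : ∀ t, ∃ x ∈ C, ∃ y ∈ T₀, ∃ z : ℂ, ∀ v, σ t v = z • σ (x * y) v)
    (hne : invariants (σ.comp T₀.subtype) ≠ ⊥) :
    Module.finrank ℂ (invariants (σ.comp T₀.subtype)) = 1 := by
  set W := invariants (σ.comp T₀.subtype) with hWdef
  have hWmem : ∀ v, v ∈ W ↔ ∀ x ∈ T₀, σ x v = v := by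
    intro v
    rw [hWdef, mem_invariants]
    exact ⟨fun h x hx => h ⟨x, hx⟩, fun h x => h x x.2⟩
  have : Nontrivial W := Submodule.nontrivial_iff_ne_bot.mpr hne
  obtain ⟨v₀, hv₀W, hv₀⟩ := Submodule.exists_mem_ne_zero_of_ne_bot hne
  have hrank : Module.rank ℂ W ≤ Cardinal.aleph0 := by
    -- Up to a scalar `t = x * y` with `x ∈ C` and `y ∈ T₀` fixing `v₀`, so the translates by `C`
    -- already span.
    have hspan : Submodule.span ℂ ((fun t => σ t v₀) '' C) = ⊤ := by
      rw [eq_top_iff, ← hσ.span_orbit_eq_top hv₀, Submodule.span_le]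
      rintro _ ⟨t, rfl⟩
      obtain ⟨x, hx, y, hy, z, hz⟩ := hcount t
      change σ t v₀ ∈ _
      rw [hz, map_mul, Module.End.mul_apply, (hWmem v₀).mp hv₀W y hy]
      exact Submodule.smul_mem _ _ (Submodule.subset_span ⟨x, hx, rfl⟩)
    refine (Submodule.rank_le W).trans ?_
    rw [← rank_top, ← hspan]
    exact (rank_span_le _).trans (Cardinal.le_aleph0_iff_set_countable.mpr (hC.image _))
  have hstab : ∀ t ∈ Subgroup.centralizer (T₀ : Set T), ∀ v ∈ W, σ t v ∈ W := by
    intro t ht v hv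
    rw [hWmem] at hv ⊢
    intro x hx
    rw [← Module.End.mul_apply, ← map_mul, (Subgroup.mem_centralizer_iff.mp ht) x hx, map_mul,
      Module.End.mul_apply, hv x hx]
  have hgen : ∀ v ∈ W, v ≠ 0 →
      W ≤ Submodule.span ℂ {w | ∃ t ∈ Subgroup.centralizer (T₀ : Set T), σ t v = w} := by
    intro v hv hv0
    choose! c hc hc1 using hchar
    -- `A` lies in `W`, while `B` lies in the sum of the eigenspaces of `T₀` with nontrivial
    -- eigencharacter and so meets `W` trivially. Since `A ⊔ B` is everything, the modular law
    -- yields `W = A`.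
    set A := Submodule.span ℂ {w | ∃ t ∈ Subgroup.centralizer (T₀ : Set T), σ t v = w} with hA
    set B := Submodule.span ℂ {w | ∃ t ∉ Subgroup.centralizer (T₀ : Set T), σ t v = w} with hB
    have hact : ∀ t, ∀ x : T₀, σ x (σ t v) = c t x • σ t v := by
      intro t x
      have h1 := hc t x x.2 v
      rw [(hWmem v).mp hv x x.2] at h1
      rw [← map_smul, ← h1, ← Module.End.mul_apply, ← Module.End.mul_apply, ← map_mul, ← map_mul]
      congr 2
      group
    let E' : (T₀ → ℂ) → Submodule ℂ V := fun χ => ⨅ x : T₀, Module.End.eigenspace (σ x) (χ x)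
    have hind : iSupIndep E' := by
      have h := Module.End.independent_iInf_maxGenEigenspace_of_forall_mapsTo
        (fun x : T₀ => σ (x : T)) fun x y φ =>
          Module.End.mapsTo_maxGenEigenspace_of_comm (by
            rw [Commute, SemiconjBy, ← map_mul, ← map_mul, hT₀ x x.2 y y.2]) φ
      exact h.mono fun χ => iInf_mono fun x => Module.End.eigenspace_le_maxGenEigenspace
    have hAW : A ≤ W := by
      rw [hA, Submodule.span_le]
      rintro _ ⟨t, ht, rfl⟩
      exact hstab t ht v hv
    have hW1 : W ≤ E' 1 := by
      intro w hw
      simp only [E', Submodule.mem_iInf, Module.End.mem_eigenspace_iff, Pi.one_apply, one_smul]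
      exact fun x => (hWmem w).mp hw x x.2
    have hB1 : B ≤ ⨆ (χ : T₀ → ℂ) (_ : χ ≠ 1), E' χ := by
      rw [hB, Submodule.span_le]
      rintro _ ⟨t, ht, rfl⟩
      refine Submodule.mem_iSup_of_mem (fun x => c t x) (Submodule.mem_iSup_of_mem ?_ ?_)
      · intro h
        apply ht
        rw [Subgroup.mem_centralizer_iff]
        exact fun x hx => (hc1 t x hx (congrFun h ⟨x, hx⟩)).symm
      · simp only [E', Submodule.mem_iInf, Module.End.mem_eigenspace_iff]
        exact hact t
    have hdisj : Disjoint W B := (hind 1).mono hW1 hB1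
    have htop : A ⊔ B = ⊤ := by
      rw [eq_top_iff, ← hσ.span_orbit_eq_top hv0, Submodule.span_le]
      rintro _ ⟨t, rfl⟩
      by_cases ht : t ∈ Subgroup.centralizer (T₀ : Set T)
      · exact Submodule.mem_sup_left (Submodule.subset_span ⟨t, ht, rfl⟩)
      · exact Submodule.mem_sup_right (Submodule.subset_span ⟨t, ht, rfl⟩)
    have : W = A := by
      calc W = (A ⊔ B) ⊓ W := by rw [htop, top_inf_eq]
        _ = A ⊔ B ⊓ W := sup_inf_assoc_of_le B hAW
        _ = A := by rw [inf_comm, hdisj.eq_bot, sup_bot_eq]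
    exact this.le
  let R : Subgroup.centralizer (T₀ : Set T) → Module.End ℂ W := fun t =>
    (σ t).restrict (hstab t t.2)
  refine finrank_eq_one_of_commute_of_irreducible hrank (Set.range R) ?_ ?_
  · rintro _ ⟨t₁, rfl⟩ _ ⟨t₂, rfl⟩
    ext w
    change σ t₁ (σ t₂ w) = σ t₂ (σ t₁ w)
    rw [← Module.End.mul_apply, ← Module.End.mul_apply, ← map_mul, ← map_mul,
      hcent t₁ t₁.2 t₂ t₂.2]
  · intro U hU
    by_cases hbot : U = ⊥
    · exact Or.inl hbot
    right
    obtain ⟨u, huU, hu⟩ := Submodule.exists_mem_ne_zero_of_ne_bot hbot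
    have hle := hgen u u.2 (fun h => hu (Subtype.ext h))
    have hle2 : W ≤ U.map W.subtype := by
      refine hle.trans (Submodule.span_le.mpr ?_)
      rintro _ ⟨t, ht, rfl⟩
      exact ⟨R ⟨t, ht⟩ u, hU _ ⟨⟨t, ht⟩, rfl⟩ u huU, rfl⟩
    rw [eq_top_iff]
    intro w _
    obtain ⟨w', hw', h⟩ := hle2 w.2
    rwa [← Subtype.ext h]

end Representation

/-! ### Residue degrees of extensions containing a root of a Kummer unit -/

/-- The quotient `(q ^ f - 1) / (q - 1) = 1 + q + ⋯ + q ^ (f - 1)` is congruent to `f`, because `q ≡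
1` modulo `n`. -/
theorem Nat.dvd_mul_of_mul_pred_dvd {n q f d : ℕ} (hq : 1 < q) (hn : n ∣ q - 1)
    (h : n * (q - 1) ∣ d * (q ^ f - 1)) : n ∣ d * f := by
  have hgeom : q ^ f - 1 = (∑ i ∈ Finset.range f, q ^ i) * (q - 1) := by
    rw [Nat.geomSum_eq hq f, Nat.div_mul_cancel]
    simpa using Nat.sub_dvd_pow_sub_pow q 1 f
  rw [hgeom, ← mul_assoc] at h
  have h1 : n ∣ d * ∑ i ∈ Finset.range f, q ^ i :=
    Nat.dvd_of_mul_dvd_mul_right (by lia) h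
  have hq1 : q ≡ 1 [MOD n] := ((Nat.modEq_iff_dvd' hq.le).mpr hn).symm
  have hsum : ∀ f, ∑ i ∈ Finset.range f, q ^ i ≡ f [MOD n] := by
    intro f
    induction f with
    | zero => rfl
    | succ f ih =>
      rw [Finset.sum_range_succ]
      exact ih.add (by simpa using hq1.pow f)
  exact (((hsum f).mul_left d).dvd_iff dvd_rfl).mp h1

section IntegralExtensions

open IsLocalRing

/-- The residue field of `O` is finite of order `q ≡ 1` modulo `n`, and `u` reduces to a generator of
its multiplicative group. -/
structure IsKummerUnit {O : Type*} [CommRing O] [IsLocalRing O] (n : ℕ) (u : O) : Prop where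
  ne_zero : n ≠ 0
  one_lt_card : 1 < Nat.card (O ⧸ maximalIdeal O)
  dvd_pred : n ∣ Nat.card (O ⧸ maximalIdeal O) - 1
  isUnit : IsUnit u
  pred_dvd : ∀ i : ℕ, u ^ i - 1 ∈ maximalIdeal O → Nat.card (O ⧸ maximalIdeal O) - 1 ∣ i

theorem Ideal.liesOver_maximalIdeal {O C : Type*} [CommRing O] [IsLocalRing O] [CommRing C]
    [Algebra O C] [Algebra.IsIntegral O C] (P : Ideal C) [P.IsMaximal] :
    P.LiesOver (maximalIdeal O) := by
  have : (P.under O).IsMaximal := Ideal.IsMaximal.under O P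
  exact ⟨(IsLocalRing.eq_maximalIdeal this).symm⟩

theorem Ideal.algebraMap_mem_iff_mem_maximalIdeal {O C : Type*} [CommRing O] [IsLocalRing O]
    [CommRing C] [Algebra O C] [Algebra.IsIntegral O C] (P : Ideal C) [P.IsMaximal] (x : O) :
    algebraMap O C x ∈ P ↔ x ∈ maximalIdeal O := by
  have := P.liesOver_maximalIdeal (O := O)
  rw [Ideal.over_def P (maximalIdeal O), Ideal.mem_comap]

theorem Ideal.cardQuot_eq_pow {O C : Type*} [CommRing O] [IsLocalRing O] [CommRing C] [Algebra O C]
    [Module.Finite O C] (P : Ideal C) [P.IsMaximal] :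
    Nat.card (C ⧸ P) = Nat.card (O ⧸ maximalIdeal O) ^ P.inertiaDeg O := by
  have := P.liesOver_maximalIdeal (O := O)
  exact (cardQuot_pow_inertiaDeg (maximalIdeal O) P).symm

variable {O C : Type*} [CommRing O] [IsDomain O] [IsDiscreteValuationRing O]
  [CommRing C] [IsDedekindDomain C] [Algebra O C] [Module.Finite O C]
  [Module.IsTorsionFree O C]

theorem Ideal.relNorm_eq_maximalIdeal_pow [CharZero O] (P : Ideal C) [P.IsMaximal] :
    relNorm O P = maximalIdeal O ^ P.inertiaDeg O := by
  have := P.liesOver_maximalIdeal (O := O)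
  have : CharZero (FractionRing O) := charZero_of_injective_algebraMap
    (IsFractionRing.injective O (FractionRing O))
  exact relNorm_eq_pow_of_isMaximal P (maximalIdeal O)

theorem IsLocalRing.maximalIdeal_pow_injective :
    Function.Injective fun k : ℕ => maximalIdeal O ^ k := by
  intro a b h
  have hne : maximalIdeal O ≠ ⊥ := IsDiscreteValuationRing.not_a_field O
  exact (Ideal.pow_right_strictAnti _ hne (Ideal.IsPrime.ne_top inferInstance)).injective h

variable {n : ℕ} {u : O}

/-- The order of an `n`-th root of a lift of a generator of the multiplicative group of the residue
field. -/
theorem Ideal.mul_pred_dvd_of_pow_sub_one_mem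
    (hu : IsKummerUnit n u) {a : C} (ha : a ^ n = algebraMap O C u) (P : Ideal C) [P.IsMaximal] {i : ℕ}
    (hi : a ^ i - 1 ∈ P) : n * (Nat.card (O ⧸ maximalIdeal O) - 1) ∣ i := by
  have hpow : ∀ j : ℕ, a ^ (n * j) - 1 ∈ P → Nat.card (O ⧸ maximalIdeal O) - 1 ∣ j := by
    intro j hj
    apply hu.pred_dvd
    rw [← P.algebraMap_mem_iff_mem_maximalIdeal]
    simpa [pow_mul, ha] using hj
  -- Here `q - 1 = n r`. Raising to the `n`-th power first gives `i = (q - 1) j = n (r j)`; then `u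
  -- ^ (r j) ≡ 1`, so `n r ∣ r j` and `n ∣ j`.
  obtain ⟨r, hr⟩ := hu.dvd_pred
  obtain ⟨j, rfl⟩ := hpow i (by
    rw [mul_comm, pow_mul]
    have h := sub_dvd_pow_sub_pow (a ^ i) 1 n
    rw [one_pow] at h
    exact P.mem_of_dvd h hi)
  have h2 := hpow (r * j) (by rw [← mul_assoc, ← hr]; exact hi)
  have hq := hu.one_lt_card
  rw [hr] at h2 ⊢
  have hr0 : 0 < r := Nat.pos_of_ne_zero fun h => by simp [h] at hr; lia
  have : n ∣ j := Nat.dvd_of_mul_dvd_mul_left hr0 (by rwa [mul_comm r n])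
  rw [mul_comm n (n * r)]
  exact Nat.mul_dvd_mul_left _ this

/-- In the residue field with `q ^ f` elements `a ^ (q ^ f - 1) = 1`, so `n (q - 1) ∣ q ^ f - 1`,
whence `n ∣ f`. -/
theorem Ideal.dvd_inertiaDeg_of_pow_eq (hu : IsKummerUnit n u) {a : C} (ha : a ^ n = algebraMap O C u)
    (P : Ideal C) [P.IsMaximal] : n ∣ P.inertiaDeg O := by
  let : Field (C ⧸ P) := Ideal.Quotient.field P
  have hcard := P.cardQuot_eq_pow (O := O)
  have : Finite (C ⧸ P) := Nat.finite_of_card_ne_zero (by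
    rw [hcard]
    exact pow_ne_zero _ (zero_lt_one.trans hu.one_lt_card).ne')
  let := Fintype.ofFinite (C ⧸ P)
  have ha0 : Ideal.Quotient.mk P a ≠ 0 := by
    rw [Ne, Ideal.Quotient.eq_zero_iff_mem]
    intro h
    have h1 : a ^ n ∈ P := P.pow_mem_of_mem h n (Nat.pos_of_ne_zero hu.ne_zero)
    rw [ha] at h1
    exact Ideal.IsPrime.ne_top inferInstance (P.eq_top_of_isUnit_mem h1 (hu.isUnit.map _))
  have h1 := FiniteField.pow_card_sub_one_eq_one _ ha0
  rw [Fintype.card_eq_nat_card, hcard, ← map_pow, ← map_one (Ideal.Quotient.mk P),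
    Ideal.Quotient.eq] at h1
  have h2 := P.mul_pred_dvd_of_pow_sub_one_mem hu ha h1
  simpa using Nat.dvd_mul_of_mul_pred_dvd (d := 1) hu.one_lt_card hu.dvd_pred (by simpa using h2)

/-- By multiplicativity it suffices to treat a prime, whose norm is the maximal ideal to the power
of its inertia degree. This is the statement that norms have valuation divisible by `n`. -/
theorem Ideal.exists_relNorm_eq_pow_of_pow_eq [CharZero O]
    (hu : IsKummerUnit n u) {a : C} (ha : a ^ n = algebraMap O C u) (I : Ideal C)
    (hI : I ≠ ⊥) : ∃ k, n ∣ k ∧ relNorm O I = maximalIdeal O ^ k := by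
  rw [← prod_normalizedFactors_eq_self hI]
  refine Multiset.prod_induction
    (fun I : Ideal C => ∃ k, n ∣ k ∧ relNorm O I = maximalIdeal O ^ k) _ ?_ ?_ ?_
  · rintro I J ⟨k, hk, hI⟩ ⟨l, hl, hJ⟩
    exact ⟨k + l, dvd_add hk hl, by rw [map_mul, hI, hJ, pow_add]⟩
  · exact ⟨0, dvd_zero n, by rw [map_one, pow_zero]⟩
  · intro Q hQ
    have hQ' : Q ≠ ⊥ := UniqueFactorizationMonoid.ne_zero_of_mem_normalizedFactors hQ
    rw [Ideal.mem_normalizedFactors_iff hI] at hQ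
    have : Q.IsMaximal := Ring.DimensionLEOne.maximalOfPrime hQ' hQ.1
    exact ⟨_, Q.dvd_inertiaDeg_of_pow_eq hu ha, Q.relNorm_eq_maximalIdeal_pow⟩

/-- If the rank is at most `n`, a uniformizer stays prime in the extension obtained by adjoining an
`n`-th root of `u`. -/
theorem Ideal.map_maximalIdeal_isMaximal_of_pow_eq [CharZero O]
    (hu : IsKummerUnit n u) {a : C} (ha : a ^ n = algebraMap O C u)
    (hrank : Module.finrank O C ≤ n) :
    ((maximalIdeal O).map (algebraMap O C)).IsMaximal := by
  set J := (maximalIdeal O).map (algebraMap O C) with hJ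
  have hm : maximalIdeal O ≠ ⊥ := IsDiscreteValuationRing.not_a_field O
  have hinj : Function.Injective (algebraMap O C) := FaithfulSMul.algebraMap_injective O C
  have hJ0 : J ≠ ⊥ := fun h => hm ((Ideal.map_eq_bot_iff_of_injective hinj).mp h)
  obtain ⟨P, hP⟩ := Ideal.exists_maximal C
  have hJP : J ≤ P := by
    rw [hJ, Ideal.map_le_iff_le_comap]
    intro x hx
    exact (P.algebraMap_mem_iff_mem_maximalIdeal x).mpr hx
  obtain ⟨I, hI⟩ := Ideal.dvd_iff_le.mpr hJP
  have hI0 : I ≠ ⊥ := by rintro rfl; exact hJ0 (by rw [hI, Ideal.mul_bot])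
  obtain ⟨k, -, hk⟩ := I.exists_relNorm_eq_pow_of_pow_eq hu ha hI0
  have hnorm : relNorm O J = maximalIdeal O ^ Module.finrank O C :=
    Ideal.relNorm_algebraMap C (maximalIdeal O)
  -- The norm of `J = P * I` has exponent at most `n`, and `P` alone contributes at least `n`. So
  -- the norm of `I` is trivial, and `I` lies in no maximal ideal.
  rw [hI, map_mul, hk, P.relNorm_eq_maximalIdeal_pow, ← pow_add] at hnorm
  have hexp := maximalIdeal_pow_injective hnorm
  have hf : n ≤ P.inertiaDeg O := Nat.le_of_dvd (P.inertiaDeg_pos O)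
    (P.dvd_inertiaDeg_of_pow_eq hu ha)
  have hk0 : k = 0 := by lia
  have hIt : I = ⊤ := by
    by_contra hne
    obtain ⟨M, hM, hIM⟩ := I.exists_le_maximal hne
    have h1 := Ideal.relNorm_mono O hIM
    rw [hk, hk0, pow_zero, M.relNorm_eq_maximalIdeal_pow, Ideal.one_eq_top, top_le_iff] at h1
    have h2 : maximalIdeal O ^ M.inertiaDeg O ≤ maximalIdeal O :=
      Ideal.pow_le_self (M.inertiaDeg_pos O).ne'
    rw [h1, top_le_iff] at h2
    exact Ideal.IsPrime.ne_top inferInstance h2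
  rw [hI, hIt, Ideal.mul_top]
  exact hP

end IntegralExtensions

/-! ### Norms and Frobenius congruences in finite extensions -/

section IntegralClosure

open IsLocalRing

variable (O F K : Type*) [CommRing O] [IsDomain O] [IsDiscreteValuationRing O] [Field F] [CharZero F]
  [Algebra O F] [IsFractionRing O F] [Field K] [Algebra F K] [FiniteDimensional F K] [Algebra O K]
  [IsScalarTower O F K]

include F

theorem integralClosure.isDedekindDomain_of_finite : IsDedekindDomain (integralClosure O K) :=
  IsIntegralClosure.isDedekindDomain O F K _

theorem integralClosure.moduleFinite_of_finite : Module.Finite O (integralClosure O K) :=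
  IsIntegralClosure.finite O F K _

theorem integralClosure.isFractionRing_of_finite : IsFractionRing (integralClosure O K) K :=
  IsIntegralClosure.isFractionRing_of_finite_extension O F K _

theorem integralClosure.isTorsionFree_of_finite : Module.IsTorsionFree O (integralClosure O K) := by
  have : FaithfulSMul O K := by
    rw [faithfulSMul_iff_algebraMap_injective, IsScalarTower.algebraMap_eq O F K]
    exact (algebraMap F K).injective.comp (IsFractionRing.injective O F)
  infer_instance

theorem charZero_of_isFractionRing : CharZero O :=
  ⟨fun a b h => Nat.cast_injective (R := F) (by
    simpa using congrArg (algebraMap O F) h)⟩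

omit [IsDomain O] [IsDiscreteValuationRing O] [CharZero F] [IsFractionRing O F]
  [FiniteDimensional F K] in
theorem integralClosure.exists_pow_eq {n : ℕ} (hn : n ≠ 0) {u : O} {a : K}
    (ha : a ^ n = algebraMap F K (algebraMap O F u)) :
    ∃ a' : integralClosure O K, (a' : K) = a ∧ a' ^ n = algebraMap O _ u := by
  rw [← IsScalarTower.algebraMap_apply] at ha
  refine ⟨⟨a, IsIntegral.of_pow (Nat.pos_of_ne_zero hn) (ha ▸ isIntegral_algebraMap)⟩, rfl, ?_⟩
  exact Subtype.ext ha

variable {O F K}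

/-- If a uniformizer of `F` is, up to a norm from an extension containing an `n`-th root of a Kummer
unit, the norm of a uniformizer of `L`, then the inertia degree of `L` is `1` modulo `n`. -/
theorem dvd_one_sub_inertiaDeg {L : Type*} [Field L] [Algebra F L] [FiniteDimensional F L]
    [Algebra O L] [IsScalarTower O F L] {n : ℕ} {u ϖ : O} (hu : IsKummerUnit n u)
    (hϖ : maximalIdeal O = Ideal.span {ϖ}) {a : K}
    (ha : a ^ n = algebraMap F K (algebraMap O F u)) {ϖL : integralClosure O L} (hϖL : Prime ϖL)
    {c : K} (hc : algebraMap O F ϖ = Algebra.norm F (ϖL : L) * Algebra.norm F c) :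
    (n : ℤ) ∣ 1 - (Ideal.span {ϖL}).inertiaDeg O := by
  have := integralClosure.isDedekindDomain_of_finite O F L
  have := integralClosure.moduleFinite_of_finite O F L
  have := integralClosure.isTorsionFree_of_finite O F L
  have := integralClosure.isDedekindDomain_of_finite O F K
  have := integralClosure.moduleFinite_of_finite O F K
  have := integralClosure.isTorsionFree_of_finite O F K
  have := integralClosure.isFractionRing_of_finite O F K
  have := charZero_of_isFractionRing O F
  obtain ⟨a', -, ha'⟩ := integralClosure.exists_pow_eq O F K hu.ne_zero ha
  have hPL : (Ideal.span {ϖL}).IsMaximal := Ring.DimensionLEOne.maximalOfPrime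
    (by simpa using hϖL.ne_zero) ((Ideal.span_singleton_prime hϖL.ne_zero).mpr hϖL)
  have hϖ0 : ϖ ≠ 0 := by
    rintro rfl
    exact IsDiscreteValuationRing.not_a_field O (by rw [hϖ]; simp)
  have hϖF : algebraMap O F ϖ ≠ 0 := (map_ne_zero_iff _ (IsFractionRing.injective O F)).mpr hϖ0
  obtain ⟨x, y, hy, hxy⟩ := IsFractionRing.div_surjective (A := integralClosure O K) c
  have hy0 := nonZeroDivisors.ne_zero hy
  have hx0 : x ≠ 0 := by
    rintro rfl
    apply hϖF
    rw [hc, ← hxy]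
    simp
  obtain ⟨kx, hkx, hx⟩ :=
    (Ideal.span {x}).exists_relNorm_eq_pow_of_pow_eq hu ha' (by simpa using hx0)
  obtain ⟨ky, hky, hy⟩ :=
    (Ideal.span {y}).exists_relNorm_eq_pow_of_pow_eq hu ha' (by simpa using hy0)
  have hL' := (Ideal.span {ϖL}).relNorm_eq_maximalIdeal_pow (O := O)
  rw [Ideal.relNorm_singleton] at hx hy hL'
  -- With `c = x / y`, clearing denominators in `hc` gives an identity of integral norms, and
  -- comparing exponents gives `1 + ky = f + kx` with `n` dividing `kx` and `ky`.
  have hmul : ϖ * Algebra.intNorm O (integralClosure O K) y =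
      Algebra.intNorm O (integralClosure O L) ϖL * Algebra.intNorm O (integralClosure O K) x := by
    apply IsFractionRing.injective O F
    have hy' : algebraMap (integralClosure O K) K y ≠ 0 :=
      (map_ne_zero_iff _ (IsFractionRing.injective _ _)).mpr hy0
    rw [map_mul, map_mul, Algebra.algebraMap_intNorm (L := K), Algebra.algebraMap_intNorm (L := L),
      Algebra.algebraMap_intNorm (L := K), (div_eq_iff hy').mp hxy, map_mul, ← mul_assoc, hc]
    rfl
  have hexp : maximalIdeal O ^ (1 + ky) =
      maximalIdeal O ^ ((Ideal.span {ϖL}).inertiaDeg O + kx) := by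
    rw [pow_add, pow_add, pow_one, ← hx, ← hy, ← hL', hϖ, Ideal.span_singleton_mul_span_singleton,
      Ideal.span_singleton_mul_span_singleton, hmul]
  have hexp' := maximalIdeal_pow_injective hexp
  have : (1 : ℤ) - (Ideal.span {ϖL}).inertiaDeg O = kx - ky := by lia
  rw [this]
  exact dvd_sub (by exact_mod_cast hkx) (by exact_mod_cast hky)

/-- If a Frobenius of residue degree `f` multiplies an `n`-th root of a Kummer unit by `z`, and
`z ^ d = 1`, then `n` divides `d * f`. -/
theorem dvd_mul_of_frobenius_eq {n f d : ℕ} {u z : O} (hu : IsKummerUnit n u)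
    {a : integralClosure O K} (ha : a ^ n = algebraMap O _ u) {ϖ : integralClosure O K}
    (hϖ : Prime ϖ) (hz : z ^ d = 1) (h : algebraMap O (integralClosure O K) z * a -
      a ^ Nat.card (O ⧸ maximalIdeal O) ^ f ∈ Ideal.span {ϖ}) : n ∣ d * f := by
  have := integralClosure.isDedekindDomain_of_finite O F K
  have := integralClosure.moduleFinite_of_finite O F K
  have := integralClosure.isTorsionFree_of_finite O F K
  have hP : (Ideal.span {ϖ}).IsMaximal := Ring.DimensionLEOne.maximalOfPrime
    (by simpa using hϖ.ne_zero) ((Ideal.span_singleton_prime hϖ.ne_zero).mpr hϖ)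
  have hau : IsUnit a := (isUnit_pow_iff hu.ne_zero).mp (ha ▸ hu.isUnit.map _)
  -- Cancelling the unit `a` gives `z ≡ a ^ (q ^ f - 1)`; the `d`-th power of this is `1 ≡ a ^ (d (q
  -- ^ f - 1))`.
  have h1 : algebraMap O (integralClosure O K) z -
      a ^ (Nat.card (O ⧸ maximalIdeal O) ^ f - 1) ∈ Ideal.span {ϖ} := by
    rwa [← Ideal.unit_mul_mem_iff_mem _ hau, mul_sub, ← pow_succ', Nat.sub_add_cancel
      (Nat.one_le_pow _ _ (zero_lt_one.trans hu.one_lt_card)), mul_comm a]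
  have h2 := Ideal.mem_of_dvd _ (sub_dvd_pow_sub_pow _ _ d) h1
  rw [← pow_mul, ← map_pow, hz, map_one, mul_comm, ← neg_mem_iff, neg_sub] at h2
  exact Nat.dvd_mul_of_mul_pred_dvd hu.one_lt_card hu.dvd_pred
    (Ideal.mul_pred_dvd_of_pow_sub_one_mem hu ha _ h2)

end IntegralClosure

/-! ### The order of the norm residue symbol of a Kummer unit and a uniformizer -/

namespace MetaplecticTorus

open IsLocalRing

variable {F : Type*} [NormedField F] [IsUltrametricDist F] [CharZero F]
  [IsDiscreteValuationRing (integers F)]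

/-- The norm residue symbol of a Kummer unit and a uniformizer has order `n`. -/
theorem dvd_of_isNormResidue_pow_eq_one {n : ℕ} {u ϖ : integers F} (hu : IsKummerUnit n u)
    (hϖ : maximalIdeal (integers F) = Ideal.span {ϖ}) {a b : Fˣ} (ha : (a : F) = u)
    (hb : (b : F) = ϖ) {ζ : rootsOfUnity n F} (hζ : IsNormResidue n a b ζ) {d : ℕ}
    (hd : ζ ^ d = 1) : n ∣ d := by
  obtain ⟨α, hα, L, hL, ϖL, φ, c, ⟨hϖL, ϖ', -, hϖ', hφ⟩, hbc, hφζ⟩ := hζ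
  have hn0 := hu.ne_zero
  have hαint : IsIntegral F α := ⟨Polynomial.X ^ n - Polynomial.C (a : F),
    Polynomial.monic_X_pow_sub_C _ hn0, by simp [hα]⟩
  have : FiniteDimensional F F⟮α⟯ := IntermediateField.adjoin.finiteDimensional hαint
  have : FiniteDimensional L L⟮α⟯ := IntermediateField.adjoin.finiteDimensional hαint.tower_top
  have : FiniteDimensional F L⟮α⟯ := FiniteDimensional.trans F L L⟮α⟯
  have hE : IntermediateField.AdjoinSimple.gen F α ^ n =
      algebraMap F F⟮α⟯ (algebraMap (integers F) F u) := by
    apply (algebraMap F⟮α⟯ (AlgebraicClosure F)).injective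
    change α ^ n = _
    rw [hα, ha]
    rfl
  have hLα : IntermediateField.AdjoinSimple.gen L α ^ n =
      algebraMap F L⟮α⟯ (algebraMap (integers F) F u) := by
    apply (algebraMap L⟮α⟯ (AlgebraicClosure F)).injective
    change α ^ n = _
    rw [hα, ha]
    rfl
  have hfn := dvd_one_sub_inertiaDeg hu hϖ hE hϖL (hb ▸ hbc)
  obtain ⟨a', ha'gen, ha'⟩ := integralClosure.exists_pow_eq (integers F) F L⟮α⟯ hn0 hLα
  obtain ⟨z, hz⟩ : ∃ z : integers F, (z : F) = (ζ : Fˣ) := by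
    refine IsIntegrallyClosed.isIntegral_iff.mp
      (IsIntegral.of_pow (Nat.pos_of_ne_zero hn0) ?_)
    have h : (((ζ : Fˣ) ^ n : Fˣ) : F) = 1 := by rw [(mem_rootsOfUnity n _).mp ζ.2, Units.val_one]
    rw [← Units.val_pow_eq_pow_val, h]
    exact isIntegral_one
  have hzd : z ^ d = 1 := by
    apply Subtype.ext
    have := congrArg (fun t : rootsOfUnity n F => ((t : Fˣ) : F)) hd
    simpa [hz] using this
  obtain ⟨y, hy⟩ := hφ a'
  have hza : algebraMap (integers F) (adjoinIntegers L α) z * a' =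
      a' ^ Nat.card (extIntegers L ⧸ Ideal.span {ϖL}) + ϖ' * y := by
    refine Subtype.ext ((algebraMap L⟮α⟯ (AlgebraicClosure F)).injective ?_)
    rw [← hy, ha'gen]
    refine Eq.trans ?_ hφζ.symm
    rw [← hz]
    rw [Subalgebra.coe_mul, map_mul, ha'gen]
    rfl
  have hqL : Nat.card (extIntegers L ⧸ Ideal.span {ϖL}) =
      Nat.card (integers F ⧸ maximalIdeal (integers F)) ^
        (Ideal.span {ϖL}).inertiaDeg (integers F) := by
    have := integralClosure.isDedekindDomain_of_finite (integers F) F L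
    have := integralClosure.moduleFinite_of_finite (integers F) F L
    have hPL : (Ideal.span {ϖL}).IsMaximal := Ring.DimensionLEOne.maximalOfPrime
      (by simpa using hϖL.ne_zero) ((Ideal.span_singleton_prime hϖL.ne_zero).mpr hϖL)
    exact (Ideal.span {ϖL}).cardQuot_eq_pow (O := integers F)
  rw [hqL] at hza
  have hdf := dvd_mul_of_frobenius_eq (F := F) hu ha' hϖ' hzd (by
    rw [hza, add_sub_cancel_left]
    exact Ideal.mul_mem_right _ _ (Ideal.mem_span_singleton_self _))
  -- The inertia degree is `1` modulo `n`, hence can be cancelled from `n ∣ d * f`.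
  have hcop : IsCoprime (n : ℤ) ((Ideal.span {ϖL}).inertiaDeg (integers F) : ℕ) := by
    obtain ⟨k, hk⟩ := hfn
    exact ⟨k, 1, by linarith⟩
  exact (Nat.isCoprime_iff_coprime.mp hcop).dvd_of_dvd_mul_right hdf

end MetaplecticTorus

/-! ### Existence of the norm residue symbol -/

theorem isGalois_of_pow_eq {F K : Type*} [Field F] [CharZero F] [Field K] [Algebra F K]
    [FiniteDimensional F K] {n : ℕ} (hn : n ≠ 0) (hζ : ∃ ζ : F, IsPrimitiveRoot ζ n) {a : K} {c : F}
    (hc : c ≠ 0) (ha : a ^ n = algebraMap F K c) (htop : F⟮a⟯ = ⊤) : IsGalois F K := by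
  obtain ⟨ζ, hζ⟩ := hζ
  have hsplit : (Polynomial.X ^ n - Polynomial.C c : Polynomial F).IsSplittingField F K := by
    constructor
    · rw [Polynomial.map_sub, Polynomial.map_pow, Polynomial.map_C, Polynomial.map_X]
      exact X_pow_sub_C_splits_of_isPrimitiveRoot
        (hζ.map_of_injective (algebraMap F K).injective) ha
    · rw [eq_top_iff, ← IntermediateField.top_toSubalgebra, ← htop,
        IntermediateField.adjoin_simple_toSubalgebra_of_isAlgebraic (IsAlgebraic.of_finite F a)]
      apply Algebra.adjoin_mono
      rw [Set.singleton_subset_iff, Polynomial.mem_rootSet_of_ne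
        (Polynomial.X_pow_sub_C_ne_zero (Nat.pos_of_ne_zero hn) c)]
      simp [ha]
  exact IsGalois.of_separable_splitting_field
    (Polynomial.separable_X_pow_sub_C c (by exact_mod_cast hn) hc)

section IntegralClosure

open IsLocalRing

variable {O F K : Type*} [CommRing O] [IsDomain O] [IsDiscreteValuationRing O] [Field F] [CharZero F]
  [Algebra O F] [IsFractionRing O F] [Field K] [Algebra F K] [FiniteDimensional F K] [Algebra O K]
  [IsScalarTower O F K]

/-- The Galois group is the automorphism group of the integral closure, with invariants `O`, so an
arithmetic Frobenius at `P` exists there and transports back to `K`. Ramification plays no role in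
existence. -/
theorem exists_frobenius [IsGalois F K] [Finite (O ⧸ maximalIdeal O)]
    (P : Ideal (integralClosure O K)) [P.IsMaximal] :
    ∃ φ : K ≃ₐ[F] K, ∀ x : integralClosure O K, ∃ y ∈ P,
      φ x = ((x ^ Nat.card (O ⧸ maximalIdeal O) + y : integralClosure O K) : K) := by
  have := integralClosure.isDedekindDomain_of_finite O F K
  have := integralClosure.moduleFinite_of_finite O F K
  have := integralClosure.isFractionRing_of_finite O F K
  have hinv := Algebra.isInvariant_of_isGalois' O F K (integralClosure O K)
  have : Finite (integralClosure O K ≃ₐ[O] integralClosure O K) :=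
    Finite.of_equiv _ (galRestrict O F K (integralClosure O K)).toEquiv
  have : Finite (integralClosure O K ⧸ P) := Nat.finite_of_card_ne_zero (by
    rw [P.cardQuot_eq_pow (O := O)]
    exact pow_ne_zero _ Nat.card_pos.ne')
  obtain ⟨σ, hσ⟩ := IsArithFrobAt.exists_of_isInvariant O
    (integralClosure O K ≃ₐ[O] integralClosure O K) P
  refine ⟨(galRestrict O F K (integralClosure O K)).symm σ, fun x => ?_⟩
  have hover : P.under O = maximalIdeal O := (P.liesOver_maximalIdeal (O := O)).over.symm
  refine ⟨σ x - x ^ Nat.card (O ⧸ maximalIdeal O), hover ▸ hσ x, ?_⟩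
  have h := algebraMap_galRestrict_apply O ((galRestrict O F K (integralClosure O K)).symm σ) x
  rw [MulEquiv.apply_symm_apply] at h
  rw [add_sub_cancel]
  exact h.symm

end IntegralClosure

namespace MetaplecticTorus

open IsLocalRing

variable {F : Type*} [NormedField F] [IsUltrametricDist F] [CharZero F]
  [IsDiscreteValuationRing (integers F)]

/-- The symbol is exhibited with `L = ⊥`, a copy of `F` that is not `F` itself. This lemma and the
next carry generation and integrality across that identification. -/
theorem adjoin_gen_bot_eq_top {F : Type*} [Field F] (α : AlgebraicClosure F) :
    F⟮IntermediateField.AdjoinSimple.gen (⊥ : IntermediateField F (AlgebraicClosure F)) α⟯ = ⊤ := by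
  rw [eq_top_iff]
  rintro ⟨x, hx⟩ -
  induction hx using IntermediateField.adjoin_induction with
  | mem x hx =>
    obtain rfl := Set.mem_singleton_iff.mp hx
    exact IntermediateField.mem_adjoin_simple_self F _
  | algebraMap x =>
    obtain ⟨x, hx⟩ := x
    obtain ⟨y, rfl⟩ := IntermediateField.mem_bot.mp hx
    exact IntermediateField.algebraMap_mem _ y
  | add x y hx hy ihx ihy => exact add_mem ihx ihy
  | inv x hx ihx => exact inv_mem ihx
  | mul x y hx hy ihx ihy => exact mul_mem ihx ihy

theorem bijective_algebraMap_extIntegers_bot : Function.Bijective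
    (algebraMap (integers F) (extIntegers (⊥ : IntermediateField F (AlgebraicClosure F)))) := by
  constructor
  · intro x y h
    have h' := congrArg (fun t : extIntegers (⊥ : IntermediateField F (AlgebraicClosure F)) =>
      ((t : (⊥ : IntermediateField F (AlgebraicClosure F))) : AlgebraicClosure F)) h
    exact Subtype.ext ((algebraMap F (AlgebraicClosure F)).injective h')
  · rintro ⟨⟨x, hx⟩, hx'⟩
    obtain ⟨y, rfl⟩ := IntermediateField.mem_bot.mp hx
    have hy : IsIntegral (integers F) y := by
      refine (isIntegral_algebraMap_iff (B := (⊥ : IntermediateField F (AlgebraicClosure F)))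
        (algebraMap F _).injective).mp hx'
    obtain ⟨z, rfl⟩ := IsIntegrallyClosed.isIntegral_iff.mp hy
    exact ⟨z, rfl⟩

set_option maxHeartbeats 800000 in
/-- The norm residue symbol of a Kummer unit and a uniformizer exists. -/
theorem exists_isNormResidue {n : ℕ} {u ϖ : integers F} (hu : IsKummerUnit n u)
    (hϖ : maximalIdeal (integers F) = Ideal.span {ϖ}) (hprim : ∃ ζ : F, IsPrimitiveRoot ζ n)
    {a b : Fˣ} (ha : (a : F) = u) (hb : (b : F) = ϖ) : ∃ ζ, IsNormResidue n a b ζ := by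
  have hn0 := hu.ne_zero
  obtain ⟨α, hα⟩ := IsAlgClosed.exists_pow_nat_eq (algebraMap F (AlgebraicClosure F) a)
    (Nat.pos_of_ne_zero hn0)
  -- The uniformizer stays prime in `F(α)`, so no auxiliary extension is needed: the witnesses are
  -- `ϖ` itself and `c = 1`.
  let L : IntermediateField F (AlgebraicClosure F) := ⊥
  have hαL : α ^ n = algebraMap L (AlgebraicClosure F) (algebraMap F L a) := hα
  have hmonic : (Polynomial.X ^ n - Polynomial.C (algebraMap F L a)).Monic :=
    Polynomial.monic_X_pow_sub_C _ hn0
  have haeval : Polynomial.aeval α (Polynomial.X ^ n - Polynomial.C (algebraMap F L a)) = 0 := by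
    rw [map_sub, map_pow, Polynomial.aeval_X, Polynomial.aeval_C, hαL, sub_self]
  have hαint : IsIntegral L α := ⟨_, hmonic, haeval⟩
  have : FiniteDimensional L L⟮α⟯ := IntermediateField.adjoin.finiteDimensional hαint
  have : FiniteDimensional F L⟮α⟯ := FiniteDimensional.trans F L L⟮α⟯
  have hrank : Module.finrank F L⟮α⟯ ≤ n := by
    have : Module.Free L L⟮α⟯ := Module.Free.of_divisionRing L L⟮α⟯
    rw [← Module.finrank_mul_finrank F L L⟮α⟯, IntermediateField.finrank_bot, one_mul,
      IntermediateField.adjoin.finrank hαint]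
    exact (Polynomial.natDegree_le_of_dvd (minpoly.dvd _ _ haeval) hmonic.ne_zero).trans
      Polynomial.natDegree_X_pow_sub_C.le
  have hgen : IntermediateField.AdjoinSimple.gen L α ^ n =
      algebraMap F L⟮α⟯ (algebraMap (integers F) F u) := by
    apply (algebraMap L⟮α⟯ (AlgebraicClosure F)).injective
    change α ^ n = _
    rw [hα, ha]
    rfl
  obtain ⟨a', ha'gen, ha'⟩ := integralClosure.exists_pow_eq (integers F) F L⟮α⟯ hn0 hgen
  have := integralClosure.isDedekindDomain_of_finite (integers F) F L⟮α⟯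
  have := integralClosure.moduleFinite_of_finite (integers F) F L⟮α⟯
  have := integralClosure.isTorsionFree_of_finite (integers F) F L⟮α⟯
  have := integralClosure.isFractionRing_of_finite (integers F) F L⟮α⟯
  have hϖ0 : ϖ ≠ 0 := by
    rintro rfl
    exact IsDiscreteValuationRing.not_a_field (integers F) (by rw [hϖ]; simp)
  have hmax := Ideal.map_maximalIdeal_isMaximal_of_pow_eq hu ha'
    (by rwa [← IsFractionRing.finrank_eq (integers F) F (adjoinIntegers L α) L⟮α⟯])
  rw [hϖ, Ideal.map_span, Set.image_singleton] at hmax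
  have hϖ'0 : algebraMap (integers F) (adjoinIntegers L α) ϖ ≠ 0 :=
    (map_ne_zero_iff _ (FaithfulSMul.algebraMap_injective _ _)).mpr hϖ0
  have hprime' := (Ideal.span_singleton_prime hϖ'0).mp hmax.isPrime
  let eL : integers F ≃+* extIntegers L := RingEquiv.ofBijective _ bijective_algebraMap_extIntegers_bot
  have hprime : Prime ϖ := (Ideal.span_singleton_prime hϖ0).mp (hϖ ▸ inferInstance)
  have hprimeL : Prime (eL ϖ) := (MulEquiv.prime_iff eL.toMulEquiv).mpr hprime
  have hcard : Nat.card (extIntegers L ⧸ Ideal.span {eL ϖ}) =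
      Nat.card (integers F ⧸ maximalIdeal (integers F)) :=
    (Nat.card_congr (Ideal.quotientEquiv _ _ eL (by
      rw [hϖ, Ideal.map_span, Set.image_singleton]; rfl)).toEquiv).symm
  have : Finite (integers F ⧸ maximalIdeal (integers F)) :=
    Nat.finite_of_card_ne_zero (zero_lt_one.trans hu.one_lt_card).ne'
  have hgal : IsGalois F L⟮α⟯ := isGalois_of_pow_eq hn0 hprim
    (a := IntermediateField.AdjoinSimple.gen L α) (ha ▸ a.ne_zero : (u : F) ≠ 0) hgen
    (adjoin_gen_bot_eq_top α)
  obtain ⟨φ, hφ⟩ := exists_frobenius (O := integers F) (F := F)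
    (Ideal.span {algebraMap (integers F) (adjoinIntegers L α) ϖ})
  let φL : L⟮α⟯ ≃ₐ[L] L⟮α⟯ := AlgEquiv.ofRingEquiv (f := φ.toRingEquiv) (by
    rintro ⟨x, hx⟩
    obtain ⟨y, rfl⟩ := IntermediateField.mem_bot.mp hx
    exact φ.commutes y)
  obtain ⟨ζ, hζ⟩ := hprim
  have hα0 : α ≠ 0 := by
    rintro rfl
    rw [zero_pow hn0] at hα
    exact a.ne_zero ((map_eq_zero _).mp hα.symm)
  have hgen' : (φ (IntermediateField.AdjoinSimple.gen L α)) ^ n =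
      IntermediateField.AdjoinSimple.gen L α ^ n := by
    rw [← map_pow, hgen, AlgEquiv.commutes]
  -- The Frobenius sends `α` to another root of `X ^ n - a`; the ratio is an `n`-th root of unity,
  -- hence comes from `F`.
  have hroot : ((φ (IntermediateField.AdjoinSimple.gen L α) : AlgebraicClosure F) / α) ^ n = 1 := by
    rw [div_pow, div_eq_one_iff_eq (pow_ne_zero n hα0)]
    exact congrArg (algebraMap L⟮α⟯ (AlgebraicClosure F)) hgen'
  have : NeZero n := ⟨hn0⟩
  obtain ⟨i, -, hi⟩ := (hζ.map_of_injective (algebraMap F (AlgebraicClosure F)).injective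
    |>.eq_pow_of_pow_eq_one hroot)
  refine ⟨hζ.toRootsOfUnity ^ i, α, hα, L, inferInstance, eL ϖ, φL, 1, ⟨hprimeL,
    algebraMap (integers F) (adjoinIntegers L α) ϖ, rfl, hprime', fun x => ?_⟩, ?_, ?_⟩
  · rw [hcard]
    obtain ⟨y, hy, hxy⟩ := hφ x
    obtain ⟨y', rfl⟩ := Ideal.mem_span_singleton.mp hy
    exact ⟨y', hxy⟩
  · have h : ((eL ϖ : extIntegers L) : L) = algebraMap F L ϖ := rfl
    rw [h, Algebra.norm_algebraMap, IntermediateField.finrank_bot, pow_one, map_one, mul_one, hb]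
  · rw [eq_div_iff hα0] at hi
    refine Eq.trans hi.symm ?_
    rw [← map_pow]
    rfl

end MetaplecticTorus

/-! ### Units and uniformizers of a `p`-adic field -/

namespace MetaplecticTorus

open IsLocalRing

section

variable {F : Type*} [NormedField F] [IsUltrametricDist F]

theorem mem_integers_iff {x : F} : x ∈ integers F ↔ ‖x‖ ≤ 1 := by
  rw [Valuation.mem_integer_iff, ← NNReal.coe_le_coe]
  rfl

theorem isUnit_integers_iff {x : integers F} : IsUnit x ↔ ‖(x : F)‖ = 1 := by
  rw [(Valuation.integer.integers (NormedField.valuation (K := F))).isUnit_iff_valuation_eq_one,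
    ← NNReal.coe_inj]
  rfl

theorem exists_zpow_mul_eq_of_irreducible [IsDiscreteValuationRing (integers F)] {b : Fˣ}
    {ϖ : integers F} (hϖ : Irreducible ϖ) (hb : (b : F) = ϖ) (t : Fˣ) :
    ∃ (k : ℤ) (w : Fˣ), ‖(w : F)‖ = 1 ∧ t = b ^ k * w := by
  have key : ∀ t : Fˣ, ‖(t : F)‖ ≤ 1 → ∃ (k : ℤ) (w : Fˣ), ‖(w : F)‖ = 1 ∧ t = b ^ k * w := by
    intro t ht
    obtain ⟨k, w, hw⟩ := IsDiscreteValuationRing.eq_unit_mul_pow_irreducible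
      (x := (⟨t, mem_integers_iff.mpr ht⟩ : integers F)) (by simp [Subtype.ext_iff]) hϖ
    refine ⟨k, Units.map (integers F).subtype.toMonoidHom w, isUnit_integers_iff.mp w.isUnit,
      Units.ext ?_⟩
    have h := congrArg (fun x : integers F => (x : F)) hw
    simp only [Subring.coe_mul, Subring.coe_pow] at h
    rw [mul_comm, h, Units.val_mul, zpow_natCast, Units.val_pow_eq_pow_val, hb]
    rfl
  rcases le_total ‖(t : F)‖ 1 with ht | ht
  · exact key t ht
  · obtain ⟨k, w, hw, h⟩ := key t⁻¹ (by
      rw [Units.val_inv_eq_inv_val, norm_inv]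
      exact inv_le_one_of_one_le₀ ht)
    refine ⟨-k, w⁻¹, by simp [hw], ?_⟩
    rw [← inv_inv t, h, mul_inv, zpow_neg]

/-- If `n` is a unit and there is a primitive `n`-th root of unity, then there is a Kummer unit. -/
theorem exists_isKummerUnit [Finite (ResidueField (integers F))] {n : ℕ}
    (hn : ‖(n : F)‖ = 1) (hprim : ∃ ζ : F, IsPrimitiveRoot ζ n) :
    ∃ u : integers F, IsKummerUnit n u := by
  have hn0 : n ≠ 0 := by
    rintro rfl
    simp at hn
  obtain ⟨ζ, hζ⟩ := hprim
  let := Fintype.ofFinite (ResidueField (integers F))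
  have hζ1 : ‖ζ‖ = 1 := by
    have h := congrArg norm hζ.pow_eq_one
    rw [norm_pow, norm_one] at h
    exact (pow_eq_one_iff_of_nonneg (norm_nonneg _) hn0).mp h
  let z : integers F := ⟨ζ, mem_integers_iff.mpr hζ1.le⟩
  have hz : IsPrimitiveRoot z n :=
    IsPrimitiveRoot.of_map_of_injective (f := (integers F).subtype) hζ Subtype.val_injective
  have hnres : residue (integers F) n ≠ 0 :=
    (residue_ne_zero_iff_isUnit _).mpr (isUnit_integers_iff.mpr (by simpa using hn))
  have hres : IsPrimitiveRoot (residue (integers F) z) n := by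
    refine ⟨by rw [← map_pow, hz.pow_eq_one, map_one], fun l hl => ?_⟩
    apply hz.dvd_of_pow_eq_one
    by_contra hne
    -- If `z ^ l ≠ 1`, then the sum of the powers `(z ^ l) ^ i` over `i < n` vanishes; but if `z ^
    -- l` reduces to `1`, the sum reduces to `n`, which is nonzero in the residue field.
    have hgeom := mul_geom_sum (z ^ l) n
    rw [← pow_mul, mul_comm l n, pow_mul, hz.pow_eq_one, one_pow, sub_self] at hgeom
    have hsum := (mul_eq_zero.mp hgeom).resolve_left (sub_ne_zero.mpr hne)
    apply hnres
    have := congrArg (residue (integers F)) hsum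
    simpa [hl] using this
  obtain ⟨g, hg⟩ := IsCyclic.exists_ofOrder_eq_natCard (α := (ResidueField (integers F))ˣ)
  have hcard : Nat.card (ResidueField (integers F))ˣ =
      Nat.card (integers F ⧸ maximalIdeal (integers F)) - 1 := Nat.card_units _
  obtain ⟨u, hu⟩ := residue_surjective (R := integers F) (g : ResidueField (integers F))
  refine ⟨u, hn0, Finite.one_lt_card (α := ResidueField (integers F)), ?_, ?_, fun i hi => ?_⟩
  · rw [← hcard]
    have h := (hres.isUnit_unit' hn0)
    rw [h.eq_orderOf]
    exact orderOf_dvd_natCard _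
  · rw [← residue_ne_zero_iff_isUnit, hu]
    exact g.ne_zero
  · rw [← hcard, ← hg]
    apply orderOf_dvd_of_pow_eq_one
    have h : residue (integers F) (u ^ i - 1) = 0 := (residue_eq_zero_iff _).mpr hi
    rw [map_sub, map_pow, hu, map_one, sub_eq_zero] at h
    exact Units.ext (by simpa using h)

end

section

variable (p : ℕ) [Fact p.Prime] (F : Type*) [NormedField F] [NormedAlgebra ℚ_[p] F]
  [IsUltrametricDist F] [FiniteDimensional ℚ_[p] F]

include p

/-- A finite extension of `ℚ_p` is a proper space, so its ring of integers, the closed unit ball, is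
compact; both properties follow from compactness. -/
theorem isDiscreteValuationRing_integers_and_finite_residueField :
    IsDiscreteValuationRing (integers F) ∧ Finite (ResidueField (integers F)) := by
  let _ : NontriviallyNormedField F :=
    { ‹NormedField F› with
      non_trivial := by
        obtain ⟨x, hx⟩ := NontriviallyNormedField.non_trivial (α := ℚ_[p])
        exact ⟨algebraMap ℚ_[p] F x, by rwa [norm_algebraMap']⟩ }
  let _ : Valued F NNReal := NormedField.toValued
  let _ : (Valued.v : Valuation F NNReal).RankOne :=
    inferInstanceAs (NormedField.valuation (K := F)).RankOne
  have : ProperSpace F := FiniteDimensional.proper ℚ_[p] F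
  have hcompact : CompactSpace (integers F) := by
    have h : (integers F : Set F) = Metric.closedBall 0 1 := by
      ext x
      simpa using mem_integers_iff
    exact isCompact_iff_compactSpace.mp (h ▸ isCompact_closedBall (0 : F) 1)
  exact (Valued.integer.compactSpace_iff_completeSpace_and_isDiscreteValuationRing_and_finite_residueField
    (K := F) (Γ₀ := NNReal)).mp hcompact |>.2

/-- A unit and a uniformizer whose norm residue symbol has order `n`. -/
theorem exists_hilbertSymbol_order {n : ℕ} (hpn : ¬ p ∣ n) (hμ : ∃ ζ : F, IsPrimitiveRoot ζ n) :
    ∃ a b : Fˣ, ‖(a : F)‖ = 1 ∧ ‖(b : F)‖ < 1 ∧ (∀ t : Fˣ, ∃ (k : ℤ) (w : Fˣ), ‖(w : F)‖ = 1 ∧ t = b ^ k * w) ∧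
      ∀ k : ℤ, hilbertSymbol n a b ^ k = 1 → (n : ℤ) ∣ k := by
  obtain ⟨_, _⟩ := isDiscreteValuationRing_integers_and_finite_residueField p F
  have : CharZero F := charZero_of_injective_algebraMap (algebraMap ℚ_[p] F).injective
  have hn : ‖(n : F)‖ = 1 := by
    rw [← map_natCast (algebraMap ℚ_[p] F) n, norm_algebraMap', Padic.norm_natCast_eq_one_iff]
    exact (Nat.Prime.coprime_iff_not_dvd Fact.out).mpr hpn
  obtain ⟨u, hu⟩ := exists_isKummerUnit hn hμ
  obtain ⟨ϖ, hϖ⟩ := IsDiscreteValuationRing.exists_irreducible (integers F)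
  have hu1 := isUnit_integers_iff.mp hu.isUnit
  let a : Fˣ := Units.mk0 (u : F) (norm_ne_zero_iff.mp (by rw [hu1]; exact one_ne_zero))
  let b : Fˣ := Units.mk0 (ϖ : F) (by simpa using hϖ.ne_zero)
  have hb1 : ‖(ϖ : F)‖ < 1 := lt_of_le_of_ne (mem_integers_iff.mp ϖ.2)
    fun h => hϖ.not_isUnit (isUnit_integers_iff.mpr h)
  refine ⟨a, b, hu1, hb1, exists_zpow_mul_eq_of_irreducible hϖ rfl, fun k hk => ?_⟩
  have hex := exists_isNormResidue hu hϖ.maximalIdeal_eq hμ (a := a) (b := b) rfl rfl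
  -- The symbol is a chosen norm residue. Every norm residue of this pair is shown to have order
  -- `n`, so existence suffices and uniqueness is not needed.
  have hres : IsNormResidue n a b (hilbertSymbol n a b) := by
    rw [hilbertSymbol, dif_pos hex]
    exact hex.choose_spec
  rw [← Int.dvd_natAbs, Int.natCast_dvd_natCast]
  refine dvd_of_isNormResidue_pow_eq_one hu hϖ.maximalIdeal_eq rfl rfl hres ?_
  rcases Int.natAbs_eq k with h | h
  · rw [h, zpow_natCast] at hk
    exact hk
  · rw [h, zpow_neg, zpow_natCast, inv_eq_one] at hk
    exact hk

end

end MetaplecticTorus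

/-! ### Points of the split torus and their adjoint action -/

noncomputable section
namespace MetaplecticTorus

section Torus

variable {F : Type*} [Field F] {A : Type*} [CommRing A] [HopfAlgebra F A]
  {X : Type*} [AddCommGroup X] (τ : A →ₐc[F] AddMonoidAlgebra F X)

@[ext]
theorem torusPoint_ext {t t' : Points F (AddMonoidAlgebra F X)}
    (h : ∀ x, t (AddMonoidAlgebra.single x 1) = t' (AddMonoidAlgebra.single x 1)) : t = t' := by
  apply WithConv.ofConv_injective
  exact AddMonoidAlgebra.algHom_ext h (Subsingleton.elim _ _)

theorem torusPoint_mul_apply (t t' : Points F (AddMonoidAlgebra F X)) (x : X) :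
    (t * t') (AddMonoidAlgebra.single x 1) =
      t (AddMonoidAlgebra.single x 1) * t' (AddMonoidAlgebra.single x 1) := by
  rw [AlgHom.convMul_apply, AddMonoidAlgebra.comul_single]
  simp

theorem torusPoint_one_apply (x : X) :
    (1 : Points F (AddMonoidAlgebra F X)) (AddMonoidAlgebra.single x 1) = 1 := by
  rw [AlgHom.convOne_apply, AddMonoidAlgebra.counit_single]
  simp

theorem torusPoint_mul_comm (t t' : Points F (AddMonoidAlgebra F X)) : t * t' = t' * t := by
  ext x
  rw [torusPoint_mul_apply, torusPoint_mul_apply, mul_comm]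

theorem torusPoint_apply_add (t : Points F (AddMonoidAlgebra F X)) (x y : X) :
    t (AddMonoidAlgebra.single (x + y) 1) =
      t (AddMonoidAlgebra.single x 1) * t (AddMonoidAlgebra.single y 1) := by
  have h : (AddMonoidAlgebra.single (x + y) 1 : AddMonoidAlgebra F X) =
      AddMonoidAlgebra.single x 1 * AddMonoidAlgebra.single y 1 := by
    rw [AddMonoidAlgebra.single_mul_single, one_mul]
  rw [h]
  exact map_mul t.ofConv _ _

theorem torusPoint_apply_zero (t : Points F (AddMonoidAlgebra F X)) :
    t (AddMonoidAlgebra.single 0 1) = 1 :=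
  map_one t.ofConv

theorem torusPoint_apply_ne_zero (t : Points F (AddMonoidAlgebra F X)) (x : X) :
    t (AddMonoidAlgebra.single x 1) ≠ 0 := by
  intro h
  have := torusPoint_apply_add t x (-x)
  rw [add_neg_cancel, torusPoint_apply_zero, h, zero_mul] at this
  exact one_ne_zero this

/-- A homomorphism from the character lattice to the units defines a point of the torus. -/
def torusPointOfHom (f : Multiplicative X →* F) : Points F (AddMonoidAlgebra F X) :=
  WithConv.toConv (AddMonoidAlgebra.lift F F X f)

theorem torusPointOfHom_apply (f : Multiplicative X →* F) (x : X) :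
    torusPointOfHom f (AddMonoidAlgebra.single x 1) = f (Multiplicative.ofAdd x) := by
  change AddMonoidAlgebra.lift F F X f _ = _
  simp

theorem mul_comm_of_mem_torusPoints {g h : Points F A} (hg : g ∈ torusPoints τ)
    (hh : h ∈ torusPoints τ) : g * h = h * g := by
  obtain ⟨t, rfl⟩ := hg
  obtain ⟨t', rfl⟩ := hh
  rw [← map_mul, ← map_mul, torusPoint_mul_comm]

variable {Y ι : Type*} [AddCommGroup Y] (P : RootPairing ι ℤ X Y)

/-- The point of the torus attached to a cocharacter. -/
def torusCochar (y : Y) (t : Fˣ) : Points F (AddMonoidAlgebra F X) :=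
  torusPointOfHom ((Units.coeHom F).comp ((zpowersHom Fˣ t).comp
    (AddMonoidHom.toMultiplicative (P.toLinearMap.flip y).toAddMonoidHom)))

theorem torusIncl_torusCochar (y : Y) (t : Fˣ) :
    torusIncl τ (torusCochar P y t) = cochar τ P y t := rfl

theorem torusCochar_apply (y : Y) (t : Fˣ) (x : X) :
    torusCochar P y t (AddMonoidAlgebra.single x 1) = ((t ^ P.toLinearMap x y : Fˣ) : F) := by
  rw [torusCochar, torusPointOfHom_apply]
  rfl

/-- Extension of functionals on the torus to functionals on the group, by restricting functions. -/
def pushFunctional (D : Functionals F (AddMonoidAlgebra F X)) : Functionals F A :=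
  WithConv.toConv (D.ofConv ∘ₗ (τ : A →ₐ[F] AddMonoidAlgebra F X).toLinearMap)

theorem pushFunctional_mul (f g : Functionals F (AddMonoidAlgebra F X)) :
    pushFunctional τ f * pushFunctional τ g = pushFunctional τ (f * g) := by
  have h := LinearMap.convMul_comp_coalgHom_distrib f g (BialgHom.toCoalgHom τ)
  apply WithConv.ofConv_injective
  exact h.symm

theorem evalAt_torusIncl (t : Points F (AddMonoidAlgebra F X)) :
    evalAt (torusIncl τ t) = pushFunctional τ (evalAt t) := rfl

/-- The elements `single x 1` are group-like, so on them convolution is pointwise multiplication and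
the two factors `t`, `t⁻¹` cancel. -/
theorem adjoint_torusPoint (t : Points F (AddMonoidAlgebra F X))
    (D : Functionals F (AddMonoidAlgebra F X)) : adjoint t D = D := by
  have hmul : ∀ (f g : Functionals F (AddMonoidAlgebra F X)) (x : X),
      (f * g) (AddMonoidAlgebra.single x 1) =
        f (AddMonoidAlgebra.single x 1) * g (AddMonoidAlgebra.single x 1) := by
    intro f g x
    rw [LinearMap.convMul_apply, AddMonoidAlgebra.comul_single]
    simp
  apply WithConv.ofConv_injective
  refine AddMonoidAlgebra.lhom_ext' fun x => LinearMap.ext_ring ?_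
  change (evalAt t * D * evalAt t⁻¹) (AddMonoidAlgebra.single x 1) =
    D (AddMonoidAlgebra.single x 1)
  have h1 : t (AddMonoidAlgebra.single x 1) * t⁻¹ (AddMonoidAlgebra.single x 1) = 1 := by
    rw [← torusPoint_mul_apply, mul_inv_cancel, torusPoint_one_apply]
  rw [hmul, hmul]
  change t (AddMonoidAlgebra.single x 1) * D (AddMonoidAlgebra.single x 1) *
    t⁻¹ (AddMonoidAlgebra.single x 1) = _
  rw [mul_right_comm, h1, one_mul]

theorem adjoint_torusIncl_pushFunctional (t : Points F (AddMonoidAlgebra F X))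
    (D : Functionals F (AddMonoidAlgebra F X)) :
    adjoint (torusIncl τ t) (pushFunctional τ D) = pushFunctional τ D := by
  rw [adjoint, ← map_inv, evalAt_torusIncl, evalAt_torusIncl, pushFunctional_mul,
    pushFunctional_mul]
  exact congrArg (pushFunctional τ) (adjoint_torusPoint t D)

theorem adjoint_torusIncl_cocharDeriv (t : Points F (AddMonoidAlgebra F X)) (y : Y) :
    adjoint (torusIncl τ t) (cocharDeriv τ P y) = cocharDeriv τ P y :=
  adjoint_torusIncl_pushFunctional τ t (WithConv.toConv
    (Finsupp.linearCombination F (fun x : X => ((P.toLinearMap x y : ℤ) : F)) ∘ₗ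
      (AddMonoidAlgebra.coeffLinearEquiv F).toLinearMap))

end Torus

/-! ### The integral torus and the maximal compact subgroup -/

section Integral

variable {F : Type*} [NormedField F] {A : Type*} [CommRing A] [HopfAlgebra F A]
  {X : Type*} [AddCommGroup X] (τ : A →ₐc[F] AddMonoidAlgebra F X)

/-- The points of the torus on which all characters take values of norm one. -/
def integralTorus (F : Type*) [NormedField F] (X : Type*) [AddCommGroup X] :
    Subgroup (Points F (AddMonoidAlgebra F X)) where
  carrier := {t | ∀ x, ‖t (AddMonoidAlgebra.single x 1)‖ = 1}
  one_mem' x := by rw [torusPoint_one_apply, norm_one]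
  mul_mem' {t t'} ht ht' x := by rw [torusPoint_mul_apply, norm_mul, ht, ht', one_mul]
  inv_mem' {t} ht x := by
    have h1 : t (AddMonoidAlgebra.single x 1) * t⁻¹ (AddMonoidAlgebra.single x 1) = 1 := by
      rw [← torusPoint_mul_apply, mul_inv_cancel, torusPoint_one_apply]
    have h2 := congrArg norm h1
    rwa [norm_mul, ht, one_mul, norm_one] at h2

theorem mem_integralTorus {t : Points F (AddMonoidAlgebra F X)} :
    t ∈ integralTorus F X ↔ ∀ x, ‖t (AddMonoidAlgebra.single x 1)‖ = 1 := Iff.rfl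

/-- The homomorphisms from `X` to the unit sphere of `F` form a closed subset of a product of
compact spheres. Each regular function restricts to a finite combination of characters, so the map
to the group is continuous. -/
theorem isCompact_map_integralTorus [IsUltrametricDist F] [ProperSpace F] :
    IsCompact (((integralTorus F X).map (torusIncl τ) : Subgroup (Points F A)) :
      Set (Points F A)) := by
  let M : Set (X → F) := {f | (∀ x, ‖f x‖ = 1) ∧ f 0 = 1 ∧ ∀ x y, f (x + y) = f x * f y}
  have hM : IsCompact M := by
    have h1 : IsCompact (Set.univ.pi fun _ : X => Metric.sphere (0 : F) 1) :=
      isCompact_univ_pi fun _ => isCompact_sphere 0 1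
    have h2 : IsClosed {f : X → F | f 0 = 1 ∧ ∀ x y, f (x + y) = f x * f y} := by
      simp only [Set.ofPred_and, Set.ofPred_forall]
      refine (isClosed_eq (continuous_apply 0) continuous_const).inter
        (isClosed_iInter fun x => isClosed_iInter fun y => isClosed_eq (by fun_prop) (by fun_prop))
    convert h1.inter_right h2 using 1
    ext f
    simp [M]
  have : CompactSpace M := isCompact_iff_compactSpace.mp hM
  let Φ : M → Points F A := fun f => torusIncl τ (torusPointOfHom
    { toFun := fun x => f.1 x.toAdd
      map_one' := f.2.2.1
      map_mul' := fun x y => f.2.2.2 _ _ })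
  have hΦ : Continuous Φ := by
    rw [continuous_induced_rng, continuous_pi_iff]
    intro a
    have : ∀ f : M, Φ f a = (τ a).coeff.sum fun x c => c * f.1 x := fun f => AddMonoidAlgebra.lift_apply' _ _
    simp only [Function.comp_def, this, Finsupp.sum]
    exact continuous_finsetSum _ fun x _ => continuous_const.mul
      ((continuous_apply x).comp continuous_subtype_val)
  convert isCompact_range hΦ
  ext g
  constructor
  · rintro ⟨t, ht, rfl⟩
    refine ⟨⟨fun x => t (AddMonoidAlgebra.single x 1), ht, torusPoint_apply_zero t,
      torusPoint_apply_add t⟩, ?_⟩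
    refine congrArg (torusIncl τ) ?_
    ext x
    rw [torusPointOfHom_apply]
    rfl
  · rintro ⟨f, rfl⟩
    refine ⟨_, ?_, rfl⟩
    intro x
    rw [torusPointOfHom_apply]
    exact f.2.1 x

variable {Y ι : Type*} [AddCommGroup Y] (P : RootPairing ι ℤ X Y) (b : P.Base)
  (e : ι → Functionals F A)

/-- The torus acts diagonally on the spanning set: root vectors are scaled by character values of
norm one, and differentials of coroots are fixed. -/
theorem adjoint_mem_chevalleyLattice [IsUltrametricDist F]
    (he : ∀ i, IsWeightVector τ (P.root i) (e i))
    {t : Points F (AddMonoidAlgebra F X)} (ht : t ∈ integralTorus F X) {v : Functionals F A}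
    (hv : v ∈ chevalleyLattice τ P b e) :
    adjoint (torusIncl τ t) v ∈ chevalleyLattice τ P b e := by
  unfold chevalleyLattice at hv
  induction hv using Submodule.span_induction with
  | mem v hv =>
    rcases hv with ⟨i, rfl⟩ | ⟨i, hi, rfl⟩
    · rw [(he i).2 t]
      exact Submodule.smul_mem _
        (⟨_, mem_integers_iff.mpr (mem_integralTorus.mp ht _).le⟩ : integers F)
        (Submodule.subset_span (Or.inl ⟨i, rfl⟩))
    · rw [adjoint_torusIncl_cocharDeriv]
      exact Submodule.subset_span (Or.inr ⟨i, hi, rfl⟩)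
  | zero =>
    rw [adjoint, mul_zero, zero_mul]
    exact zero_mem _
  | add v w _ _ hv hw =>
    rw [adjoint, mul_add, add_mul]
    exact add_mem hv hw
  | smul c v _ hv =>
    have h : adjoint (torusIncl τ t) (c • v) = c • adjoint (torusIncl τ t) v := by
      change evalAt _ * ((c : F) • v) * evalAt _ = (c : F) • (evalAt _ * v * evalAt _)
      rw [mul_smul_comm, smul_mul_assoc]
    rw [h]
    exact Submodule.smul_mem _ c hv

/-- The integral points of the torus lie in the maximal compact subgroup. -/
theorem map_integralTorus_le [IsUltrametricDist F] [ProperSpace F] (he : ∀ i, IsWeightVector τ (P.root i) (e i))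
    {K : Subgroup (Points F A)} (hK : IsChevalleyMaximalCompact τ P b e K) :
    (integralTorus F X).map (torusIncl τ) ≤ K := by
  refine hK.2 ⟨isCompact_map_integralTorus τ, ?_⟩
  rintro _ ⟨t, ht, rfl⟩ v hv
  exact adjoint_mem_chevalleyLattice τ P b e he ht hv

theorem torusCochar_mem_integralTorus (y : Y) {a : Fˣ} (ha : ‖(a : F)‖ = 1) :
    torusCochar P y a ∈ integralTorus F X := by
  intro x
  rw [torusCochar_apply, Units.val_zpow_eq_zpow_val, norm_zpow, ha, one_zpow]

/-- Every point of the torus is the product of the value of a cocharacter at a uniformizer and an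
integral point. -/
theorem exists_torusCochar_mul {b : Fˣ} (hb : ‖(b : F)‖ < 1)
    (hdec : ∀ t : Fˣ, ∃ (k : ℤ) (w : Fˣ), ‖(w : F)‖ = 1 ∧ t = b ^ k * w)
    (t : Points F (AddMonoidAlgebra F X)) :
    ∃ y : Y, ∃ r ∈ integralTorus F X, t = torusCochar P y b * r := by
  have hb0 : 0 < ‖(b : F)‖ := norm_pos_iff.mpr b.ne_zero
  have hk : ∀ x : X, ∃ k : ℤ, ‖t (AddMonoidAlgebra.single x 1)‖ = ‖(b : F)‖ ^ k := by
    intro x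
    obtain ⟨k, w, hw, h⟩ := hdec (Units.mk0 _ (torusPoint_apply_ne_zero t x))
    refine ⟨k, ?_⟩
    have h' := congrArg (fun u : Fˣ => ‖(u : F)‖) h
    simpa [hw] using h'
  choose k hk using hk
  have hinj := zpow_right_injective₀ hb0 hb.ne
  -- The valuation of `t` along characters is additive in the character, so the perfect pairing
  -- represents it by a cocharacter `y`; dividing by `y ⊗ b` leaves norm-one values.
  let kHom : X →ₗ[ℤ] ℤ := (AddMonoidHom.mk' k fun x y => hinj (by
    change ‖(b : F)‖ ^ k (x + y) = ‖(b : F)‖ ^ (k x + k y)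
    rw [← hk, torusPoint_apply_add, norm_mul, hk, hk, zpow_add₀ hb0.ne'])).toIntLinearMap
  obtain ⟨y, hy⟩ := (P.toLinearMap.flip.toPerfPair).surjective kHom
  have hy' : ∀ x, P.toLinearMap x y = k x := fun x => LinearMap.congr_fun hy x
  refine ⟨y, (torusCochar P y b)⁻¹ * t, ?_, by rw [mul_inv_cancel_left]⟩
  intro x
  have h1 : t (AddMonoidAlgebra.single x 1) = torusCochar P y b (AddMonoidAlgebra.single x 1) *
      ((torusCochar P y b)⁻¹ * t) (AddMonoidAlgebra.single x 1) := by
    rw [← torusPoint_mul_apply, mul_inv_cancel_left]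
  have h2 := congrArg norm h1
  rw [norm_mul, torusCochar_apply, Units.val_zpow_eq_zpow_val, norm_zpow, hy', hk] at h2
  exact (mul_eq_left₀ (zpow_ne_zero _ hb0.ne')).mp h2.symm

end Integral

end MetaplecticTorus
end

/-! ### Commutators in the metaplectic torus -/

noncomputable section
namespace MetaplecticTorus

section Metaplectic

variable {F : Type*} [NormedField F] [IsUltrametricDist F] {n : ℕ}
  {A : Type*} [CommRing A] [HopfAlgebra F A] {X Y ι : Type*} [AddCommGroup X] [AddCommGroup Y]
  {τ : A →ₐc[F] AddMonoidAlgebra F X} {P : RootPairing ι ℤ X Y}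
  {Q : LinearMap.BilinForm ℤ Y} {G : Type*} [Group G]
  {inc : rootsOfUnity n F →* G} {π : G →* Points F A} {Kbar : Subgroup (Points F A)}
  {s : Kbar →* G}

/-- Elements of the metaplectic torus lying in the image of the splitting commute. -/
theorem mul_comm_of_mem_range_splitting (hs : ∀ x : Kbar, π (s x) = x) {x y : G}
    (hx : x ∈ s.range) (hy : y ∈ s.range) (hxT : π x ∈ torusPoints τ) (hyT : π y ∈ torusPoints τ) :
    x * y = y * x := by
  obtain ⟨k, rfl⟩ := hx
  obtain ⟨l, rfl⟩ := hy
  rw [hs] at hxT hyT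
  rw [← map_mul, ← map_mul]
  exact congrArg s (Subtype.ext (mul_comm_of_mem_torusPoints τ hxT hyT))

/-- The centralizer in the metaplectic torus of the image of the integral torus is commutative. -/
theorem mul_comm_of_centralizes (hinc : Function.Injective inc)
    (hcomm : ∀ (y₁ y₂ : Y) (t₁ t₂ : Fˣ) (g₁ g₂ : G),
      π g₁ = cochar τ P y₁ t₁ → π g₂ = cochar τ P y₂ t₂ →
        g₁ * g₂ * g₁⁻¹ * g₂⁻¹ = inc (hilbertSymbol n t₁ t₂ ^ Q y₁ y₂))
    (hs : ∀ x : Kbar, π (s x) = x)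
    (hK : (integralTorus F X).map (torusIncl τ) ≤ Kbar) {a b : Fˣ} (ha : ‖(a : F)‖ = 1)
    (hb : ‖(b : F)‖ < 1) (hdec : ∀ t : Fˣ, ∃ (k : ℤ) (w : Fˣ), ‖(w : F)‖ = 1 ∧ t = b ^ k * w)
    (hord : ∀ k : ℤ, hilbertSymbol n a b ^ k = 1 → (n : ℤ) ∣ k) {t₁ t₂ : G}
    (h₁T : π t₁ ∈ torusPoints τ) (h₂T : π t₂ ∈ torusPoints τ)
    (h₁ : ∀ x ∈ s.range, π x ∈ torusPoints τ → t₁ * x = x * t₁)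
    (h₂ : ∀ x ∈ s.range, π x ∈ torusPoints τ → t₂ * x = x * t₂) : t₁ * t₂ = t₂ * t₁ := by
  have hlift : ∀ r ∈ integralTorus F X, ∃ k ∈ s.range, π k = torusIncl τ r := fun r hr =>
    ⟨s ⟨_, hK ⟨r, hr, rfl⟩⟩, ⟨_, rfl⟩, hs _⟩
  -- The integral part of `t` is lifted into the image of `s`. As that lift `k` commutes with `T₀`,
  -- the factor `z = t k⁻¹` over `y ⊗ b` still centralizes `T₀`.
  have hsplit : ∀ t : G, π t ∈ torusPoints τ →
      (∀ x ∈ s.range, π x ∈ torusPoints τ → t * x = x * t) →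
      ∃ (y : Y) (z k : G), t = z * k ∧ π z = cochar τ P y b ∧ k ∈ s.range ∧ π k ∈ torusPoints τ ∧
        ∀ x ∈ s.range, π x ∈ torusPoints τ → z * x = x * z := by
    rintro t ⟨t', ht'⟩ ht
    obtain ⟨y, r, hr, rfl⟩ := exists_torusCochar_mul P hb hdec t'
    obtain ⟨k, hk, hkr⟩ := hlift r hr
    have hkT : π k ∈ torusPoints τ := ⟨r, hkr.symm⟩
    refine ⟨y, t * k⁻¹, k, by group, ?_, hk, hkT, fun x hx hxT => ?_⟩
    · rw [map_mul, map_inv, hkr, ← ht', map_mul, mul_inv_cancel_right, torusIncl_torusCochar]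
    · have hkx : Commute k x := mul_comm_of_mem_range_splitting hs hk hx hkT hxT
      exact Commute.mul_left (ht x hx hxT) hkx.inv_left
  obtain ⟨y₁, z₁, k₁, rfl, hz₁, hk₁, hk₁T, hc₁⟩ := hsplit t₁ h₁T h₁
  obtain ⟨y₂, z₂, k₂, rfl, hz₂, hk₂, hk₂T, hc₂⟩ := hsplit t₂ h₂T h₂
  -- Since `a` is a unit, `y₁ ⊗ a` lifts into the image of `s`, and `z₂` commutes with the lift. The
  -- commutator formula turns this into a trivial power of a symbol of order `n`.
  have hQ : (n : ℤ) ∣ Q y₁ y₂ := by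
    obtain ⟨k, hk, hkr⟩ := hlift _ (torusCochar_mem_integralTorus P y₁ ha)
    apply hord
    apply hinc
    rw [map_one, ← hcomm y₁ y₂ a b k z₂ hkr hz₂, ← hc₂ k hk ⟨_, hkr.symm⟩]
    group
  have hzz : Commute z₁ z₂ := by
    have h := hcomm y₁ y₂ b b z₁ z₂ hz₁ hz₂
    obtain ⟨m, hm⟩ := hQ
    -- About `(b, b)_n` it only matters that it is an `n`-th root of unity.
    have hroot : hilbertSymbol n b b ^ (n : ℤ) = 1 := by
      rw [zpow_natCast]
      exact Subtype.ext ((mem_rootsOfUnity _ _).mp (hilbertSymbol n b b).2)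
    rw [hm, zpow_mul, hroot, one_zpow, map_one] at h
    exact mul_inv_eq_iff_eq_mul.mp (mul_inv_eq_one.mp h)
  have hzk : Commute z₁ k₂ := hc₁ k₂ hk₂ hk₂T
  have hkz : Commute k₁ z₂ := (hc₂ k₁ hk₁ hk₁T).symm
  have hkk : Commute k₁ k₂ := mul_comm_of_mem_range_splitting hs hk₁ hk₂ hk₁T hk₂T
  exact (hzz.mul_right hzk).mul_left (hkz.mul_right hkk)

end Metaplectic

end MetaplecticTorus
end

/-! ### Dimension of the space of unramified vectors -/

open MetaplecticTorus in
theorem proposition2p2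
    -- the local field `F` and the integer `n`
    (p : ℕ) [Fact p.Prime] (n : ℕ) (hpn : ¬ p ∣ n)
    {F : Type*} [NormedField F] [NormedAlgebra ℚ_[p] F] [IsUltrametricDist F]
    [FiniteDimensional ℚ_[p] F] (hμ : ∃ ζ : F, IsPrimitiveRoot ζ n)
    -- the split reductive group, its split maximal torus, root datum, Chevalley basis
    {A : Type*} [CommRing A] [HopfAlgebra F A]
    {X Y ι : Type*} [AddCommGroup X] [Module.Finite ℤ X] [AddCommGroup Y] [Module.Finite ℤ Y]
    [Finite ι] (τ : A →ₐc[F] AddMonoidAlgebra F X) (hτ : IsSplitReductive τ)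
    (P : RootPairing ι ℤ X Y) (hP : HasRoots τ P) (b : P.Base)
    (e : ι → Functionals F A) (he : IsChevalleySystem τ P e)
    -- the maximal compact subgroup
    (Kbar : Subgroup (Points F A)) (hK : IsChevalleyMaximalCompact τ P b e Kbar)
    -- the bilinear form on the cocharacter lattice
    (Q : LinearMap.BilinForm ℤ Y) (hQ : ∀ y₁ y₂, Q y₁ y₂ = Q y₂ y₁)
    -- the central extension, with its commutators on the torus
    {G : Type*} [Group G] [TopologicalSpace G] [IsTopologicalGroup G]
    (inc : rootsOfUnity n F →* G) (π : G →* Points F A)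
    (hπ : IsTopologicalCentralExtension inc π)
    (hcomm : ∀ (y₁ y₂ : Y) (t₁ t₂ : Fˣ) (g₁ g₂ : G),
      π g₁ = cochar τ P y₁ t₁ → π g₂ = cochar τ P y₂ t₂ →
        g₁ * g₂ * g₁⁻¹ * g₂⁻¹ = inc (hilbertSymbol n t₁ t₂ ^ Q y₁ y₂))
    -- the splitting over the maximal compact subgroup
    (s : Kbar →* G) (hs : ∀ x : Kbar, π (s x) = x)
    -- the irreducible genuine representation of the metaplectic torus
    (ε : rootsOfUnity n F →* ℂˣ) (hε : Function.Injective ε)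
    {V : Type*} [AddCommGroup V] [Module ℂ V]
    (σ : Representation ℂ ((torusPoints τ).comap π) V) (hσ : σ.IsIrreducible)
    (hgen : IsGenuine inc ε ((torusPoints τ).comap π) σ)
    -- it is unramified
    (hur : fixedVectors ((torusPoints τ).comap π) s.range σ ≠ ⊥) :
    Module.finrank ℂ (fixedVectors ((torusPoints τ).comap π) s.range σ) = 1 := by
  obtain ⟨a, ϖ, ha, hϖ, hdec, hord⟩ := exists_hilbertSymbol_order p F hpn hμ
  have : ProperSpace F := FiniteDimensional.proper ℚ_[p] F
  have hKT : (integralTorus F X).map (torusIncl τ) ≤ Kbar :=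
    map_integralTorus_le τ P b e he.isWeightVector hK
  have hinc : Function.Injective inc := hπ.isEmbedding.injective
  have hker : ∀ g : G, π g = 1 → ∃ m, inc m = g := fun g hg =>
    MonoidHom.mem_range.mp (hπ.exact ▸ (MonoidHom.mem_ker.mpr hg))
  have hscalar : ∀ (t t' : (torusPoints τ).comap π) (m : rootsOfUnity n F),
      (t : G) = inc m * t' → ∀ v, σ t v = (ε m : ℂ) • σ t' v := by
    intro t t' m h v
    have hm : (t * t'⁻¹ : (torusPoints τ).comap π) = inc m := by simp [h]
    rw [← hgen _ _ hm, ← Module.End.mul_apply, ← map_mul, inv_mul_cancel_right]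
  have hmemT : ∀ x : (torusPoints τ).comap π, π x ∈ torusPoints τ := fun x => x.2
  choose c hc using fun y : Y => hπ.isOpenQuotientMap.surjective (cochar τ P y ϖ)
  have hcT : ∀ y, c y ∈ (torusPoints τ).comap π := fun y => by
    rw [Subgroup.mem_comap, hc]
    exact ⟨_, torusIncl_torusCochar τ P y ϖ⟩
  have : Countable Y := by
    obtain ⟨k, f, hf⟩ := Module.Finite.exists_fin' ℤ Y
    exact hf.countable
  refine Representation.finrank_invariants_eq_one hσ (s.range.subgroupOf _) ?_ ?_ ?_
    (Set.range fun y => ⟨c y, hcT y⟩) (Set.countable_range _) ?_ hur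
  · intro x hx y hy
    exact Subtype.ext (mul_comm_of_mem_range_splitting hs hx hy (hmemT x) (hmemT y))
  · intro t x hx
    -- The projections of `x` and `t` commute, so `t⁻¹ x t` is `x` times some `m ∈ μ_n`, acting by
    -- `ε m`; injectivity of `ε` detects `m = 1`.
    obtain ⟨m, hm⟩ := hker ((t⁻¹ * x * t * x⁻¹ : (torusPoints τ).comap π) : G) (by
      have h := mul_comm_of_mem_torusPoints τ (hmemT x) (hmemT t)
      push_cast
      simp only [map_mul, map_inv]
      rw [mul_assoc (π t)⁻¹, h]
      group)
    have hm' : ((t⁻¹ * x * t : (torusPoints τ).comap π) : G) = inc m * x := by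
      rw [hm]
      push_cast
      group
    refine ⟨ε m, hscalar _ _ m hm', fun h1 => ?_⟩
    have hm1 : m = 1 := hε (by rw [map_one]; exact Units.ext h1)
    rw [hm1, map_one, one_mul] at hm'
    have h : t⁻¹ * x * t = x := Subtype.ext hm'
    calc t * x = t * (t⁻¹ * x * t) := by rw [h]
      _ = x * t := by group
  · intro t₁ ht₁ t₂ ht₂
    refine Subtype.ext (mul_comm_of_centralizes hinc hcomm hs hKT ha hϖ hdec hord (hmemT t₁)
      (hmemT t₂) (fun x hx hxT => ?_) (fun x hx hxT => ?_))
    · exact (congrArg Subtype.val (Subgroup.mem_centralizer_iff.mp ht₁ ⟨x, hxT⟩ hx)).symm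
    · exact (congrArg Subtype.val (Subgroup.mem_centralizer_iff.mp ht₂ ⟨x, hxT⟩ hx)).symm
  · intro t
    obtain ⟨t', ht'⟩ := hmemT t
    obtain ⟨y, r, hr, rfl⟩ := exists_torusCochar_mul P hϖ hdec t'
    let k : Kbar := ⟨torusIncl τ r, hKT ⟨r, hr, rfl⟩⟩
    have hkT : s k ∈ (torusPoints τ).comap π := by
      rw [Subgroup.mem_comap, hs]
      exact ⟨r, rfl⟩
    -- The element `t` and the product of the chosen lift `c y` with `s k` lie over the same torus
    -- point, hence differ by an element of `μ_n`, which acts as a scalar.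
    obtain ⟨m, hm⟩ := hker (t * (c y * s k)⁻¹) (by
      rw [map_mul, map_inv, map_mul, hc, hs, ← ht', map_mul, torusIncl_torusCochar]
      exact mul_inv_cancel _)
    refine ⟨_, ⟨y, rfl⟩, ⟨s k, hkT⟩, ⟨k, rfl⟩, ε m, hscalar _ _ m ?_⟩
    rw [hm]
    push_cast
    group
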